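/- Let $X$ and $Y$ be locally compact Hausdorff spaces, and let $C_c(X)$ be the space of real-valued continuous functions on $X$ with compact support. For $f\in C_c(X)$ let $B(f)$ be the set of all functions in $C_c(X)$ of the form $\varphi\circ f$ with $\varphi$ continuous on $f(X)$ and $\varphi(0)=0$. A *quasi-integral* (or *quasi-linear functional*) on $C_c(X)$ is a map $\rho:C_c(X)\to\mathbb R$ such that $\rho(af)=a\rho(f)$ for $a\in\mathbb R$; $\rho(g+h)=\rho(g)+\rho(h)$ whenever $g,h\in B(f)$ for some $f\in C_c(X)$; and $\rho(f)\ge 0$ whenever $f\ge 0$. A *topological measure* on $X$ is a $[0,\infty]$-valued function $\mu$ on the open and the closed subsets of $X$, not identically $\infty$, such that (i) $\mu(A\sqcup B)=\mu(A)+\mu(B)$ if each of $A$, $B$ and the disjoint union $A\sqcup B$ is compact or open; (ii) $\mu(U)=\sup\{\mu(K): K\subseteq U,\ K\text{ compact}\}$ for $U$ open; (iii) $\mu(F)=\inf\{\mu(U): F\subseteq U,\ U\text{ open}\}$ for $F$ closed. It is *simple* if it assumes no values other than $0$ and $1$, and *almost simple* if $\mu=c\mu'$ with $c\in(0,\infty)$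 and $\mu'$ a simple topological measure. The topological measure $\mu_\rho$ corresponding to a quasi-integral $\rho$ is given by $\mu_\rho(U)=\sup\{\rho(f): f\in C_c(X),\ 0\le f\le 1,\ \operatorname{supp} f\subseteq U\}$ for $U$ open and $\mu_\rho(F)=\inf\{\mu_\rho(U): F\subseteq U,\ U\text{ open}\}$ for $F$ closed. A quasi-integral $\rho$ is *simple* (*almost simple*) if $\mu_\rho$ is. Let $\eta$ be a quasi-integral on $C_c(Y)$ and $\rho$ a quasi-integral on $C_c(X)$. For $f\in C_c(X\times Y)$ put $f_y(x)=f(x,y)$. Then $y\mapsto\rho(f_y)$ belongs to $C_c(Y)$, and the repeated functional $\eta\times\rho$ on $C_c(X\times Y)$ is defined by $(\eta\times\rho)(f)=\eta\big(y\mapsto\rho(f_y)\big)$. **Theorem.** 1. $\eta\times\rho$ is a quasi-linear functional if and only if $\eta$ is linear or $\rho$ is almost simple. 2. If $\mu_\rho$ assumes more than two values and $\eta\times\rho$ is a quasi-linear functional, then $\eta$ is linear. 3. If $\eta$ is linear or $\rho$ is simple, then $\eta\times\rho$ is a quasi-linear functional. 4. If $\mu_\rho(X)=1$, then $\eta\times\rho$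 is a quasi-linear functional if and only if $\eta$ is linear or $\rho$ is simple. -/

import Mathlib

open scoped CompactlySupported ENNReal NNReal Topology

section QuasiIntegrals

variable {X : Type*} [TopologicalSpace X]

/-- The (closed) subalgebra `B(f)` of `C_c(X)` singly generated by `f`: all functions `φ ∘ f` in
`C_c(X)` with `φ` continuous on `f(X)` and `φ 0 = 0`. -/
def singlyGenerated (f : C_c(X, ℝ)) : Set C_c(X, ℝ) :=
  {g | ∃ φ : ℝ → ℝ, ContinuousOn φ (Set.range f) ∧ φ 0 = 0 ∧ ∀ x, g x = φ (f x)}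

/-- Quasi-integrals (quasi-linear functionals) on `C_c(X)`. -/
structure IsQuasiIntegral (ρ : C_c(X, ℝ) → ℝ) : Prop where
  homogeneous : ∀ (a : ℝ) (f : C_c(X, ℝ)), ρ (a • f) = a * ρ f
  additive : ∀ f : C_c(X, ℝ), ∀ g ∈ singlyGenerated f, ∀ h ∈ singlyGenerated f,
    ρ (g + h) = ρ g + ρ h
  positive : ∀ f : C_c(X, ℝ), (∀ x, 0 ≤ f x) → 0 ≤ ρ f

/-- Topological measures. Only the values of `μ` on open sets and on closed sets matter. -/
structure IsTopologicalMeasure (μ : Set X → ℝ≥0∞) : Prop where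
  not_top : ∃ A, (IsClosed A ∨ IsOpen A) ∧ μ A ≠ ∞
  additive : ∀ A B : Set X, Disjoint A B → (IsCompact A ∨ IsOpen A) → (IsCompact B ∨ IsOpen B) →
    (IsCompact (A ∪ B) ∨ IsOpen (A ∪ B)) → μ (A ∪ B) = μ A + μ B
  inner : ∀ U : Set X, IsOpen U → μ U = ⨆ (K : Set X) (_ : IsCompact K) (_ : K ⊆ U), μ K
  outer : ∀ F : Set X, IsClosed F → μ F = ⨅ (U : Set X) (_ : IsOpen U) (_ : F ⊆ U), μ U

/-- A topological measure is simple if it only assumes the values `0` and `1`. -/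
structure IsSimpleTM (μ : Set X → ℝ≥0∞) : Prop extends IsTopologicalMeasure μ where
  values : ∀ A : Set X, (IsClosed A ∨ IsOpen A) → μ A = 0 ∨ μ A = 1

/-- A topological measure is almost simple if it is a positive scalar multiple of a simple one. -/
def IsAlmostSimpleTM (μ : Set X → ℝ≥0∞) : Prop :=
  ∃ (c : ℝ≥0) (μ' : Set X → ℝ≥0∞), 0 < c ∧ IsSimpleTM μ' ∧
    ∀ A : Set X, (IsClosed A ∨ IsOpen A) → μ A = (c : ℝ≥0∞) * μ' A

/-- The value on the open set `U` of the set function corresponding to `ρ`: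
the supremum of `ρ f` over `f ∈ C_c(X)` with `0 ≤ f ≤ 1` and `supp f ⊆ U`. -/
noncomputable def tmOnOpen (ρ : C_c(X, ℝ) → ℝ) (U : Set X) : ℝ≥0∞ :=
  ⨆ (f : C_c(X, ℝ)) (_ : ∀ x, 0 ≤ f x ∧ f x ≤ 1) (_ : tsupport f ⊆ U), ENNReal.ofReal (ρ f)

/-- The topological measure `μ_ρ` corresponding to a quasi-integral `ρ`: the infimum of `tmOnOpen`
over the open supersets (which on an open set is `tmOnOpen` itself, see `tmOf_of_isOpen`). -/
noncomputable def tmOf (ρ : C_c(X, ℝ) → ℝ) (A : Set X) : ℝ≥0∞ :=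
  ⨅ (U : Set X) (_ : IsOpen U) (_ : A ⊆ U), tmOnOpen ρ U

theorem tmOf_of_isOpen (ρ : C_c(X, ℝ) → ℝ) {U : Set X} (hU : IsOpen U) :
    tmOf ρ U = tmOnOpen ρ U := by
  apply le_antisymm
  · exact iInf_le_of_le U (iInf_le_of_le hU (iInf_le_of_le subset_rfl le_rfl))
  · refine le_iInf fun V => le_iInf fun _ => le_iInf fun hUV => ?_
    refine iSup_mono fun f => iSup_mono fun _ => ?_
    exact iSup_mono' fun h => ⟨h.trans hUV, le_rfl⟩

/-- A quasi-integral is simple if its topological measure is. -/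
def IsSimpleQI (ρ : C_c(X, ℝ) → ℝ) : Prop := IsSimpleTM (tmOf ρ)

/-- A quasi-integral is almost simple if its topological measure is. -/
def IsAlmostSimpleQI (ρ : C_c(X, ℝ) → ℝ) : Prop := IsAlmostSimpleTM (tmOf ρ)

end QuasiIntegrals

/-! Uniform continuity of a quasi-integral on functions with supports in a common compact set,
needed for `y ↦ ρ (f_y)` to be continuous. -/

namespace IsQuasiIntegral

variable {X : Type*} [TopologicalSpace X] {ρ : C_c(X, ℝ) → ℝ}

theorem map_zero (hρ : IsQuasiIntegral ρ) : ρ 0 = 0 := by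
  have := hρ.homogeneous 0 0
  simpa using this

theorem le_of_eq_on_support (hρ : IsQuasiIntegral ρ) (f g : C_c(X, ℝ)) (c : ℝ) (hc : 0 ≤ c)
    (hf : ∀ x, 0 ≤ f x) (hg : ∀ x, 0 ≤ g x) (hgc : ∀ x, g x ≤ c)
    (hfc : ∀ x, f x ≤ c) (hfg : ∀ x, f x ≠ 0 → g x = c) : ρ f ≤ ρ g := by
  have h1 : f ∈ singlyGenerated (f + g) := by
    refine ⟨fun v => max (v - c) 0, by fun_prop, by simpa using hc, fun x => ?_⟩
    by_cases h : f x = 0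
    · have := hgc x
      simp [h, this]
    · have := hf x
      simp [hfg x h, this]
  have h2 : g - f ∈ singlyGenerated (f + g) := by
    refine ⟨fun v => min v c - max (v - c) 0, by fun_prop, by simp [hc], fun x => ?_⟩
    by_cases h : f x = 0
    · have := hgc x
      simp [h, this]
    · have := hf x
      simp [hfg x h, this]
  have h3 := hρ.additive _ _ h1 _ h2
  have h4 : 0 ≤ ρ (g - f) := hρ.positive _ fun x => by
    by_cases h : f x = 0
    · simpa [h] using hg x
    · simpa [hfg x h] using hfc x
  rw [add_sub_cancel] at h3
  linarith

theorem map_truncate_succ (hρ : IsQuasiIntegral ρ) (f : C_c(X, ℝ)) {δ : ℝ} (hδ : 0 ≤ δ) (n : ℕ) :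
    ρ (f.compLeft ⟨fun v => min v ((n + 1 : ℕ) * δ), by fun_prop⟩) =
      ρ (f.compLeft ⟨fun v => min v (n * δ), by fun_prop⟩) +
      ρ (f.compLeft ⟨fun v => min (max (v - n * δ) 0) δ, by fun_prop⟩) := by
  have h0 : 0 ≤ n * δ := by positivity
  have h0' : 0 ≤ ((n + 1 : ℕ) : ℝ) * δ := by positivity
  rw [← hρ.additive f]
  · congr 1
    ext x
    rw [CompactlySupportedContinuousMap.add_apply,
      CompactlySupportedContinuousMap.compLeft_apply (by simpa using h0'),
      CompactlySupportedContinuousMap.compLeft_apply (by simpa using h0),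
      CompactlySupportedContinuousMap.compLeft_apply (by simp [h0, hδ])]
    simp only [ContinuousMap.coe_mk, Nat.cast_add, Nat.cast_one, add_mul, one_mul]
    rcases le_total (f x) (n * δ) with h | h
    · rw [min_eq_left h, min_eq_left (by linarith), max_eq_right (by linarith), min_eq_left hδ]
      simp
    · rw [min_eq_right h, max_eq_left (by linarith)]
      rcases le_total (f x) (n * δ + δ) with h' | h'
      · rw [min_eq_left h', min_eq_left (by linarith)]; ring
      · rw [min_eq_right h', min_eq_right (by linarith)]
  · exact ⟨fun v => min v (n * δ), by fun_prop, by simpa using h0,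
      fun x => CompactlySupportedContinuousMap.compLeft_apply (by simpa using h0) _ _⟩
  · exact ⟨fun v => min (max (v - n * δ) 0) δ, by fun_prop, by simp [h0, hδ],
      fun x => CompactlySupportedContinuousMap.compLeft_apply (by simp [h0, hδ]) _ _⟩

theorem le_add_of_nonneg (hρ : IsQuasiIntegral ρ) (f g h : C_c(X, ℝ)) {δ : ℝ} (hδ : 0 < δ)
    (hf : ∀ x, 0 ≤ f x) (hg : ∀ x, 0 ≤ g x) (hh : ∀ x, 0 ≤ h x ∧ h x ≤ 1)
    (hfh : ∀ x, f x ≠ 0 → h x = 1) (hfg : ∀ x, f x ≤ g x + δ) : ρ f ≤ ρ g + 2 * δ * ρ h := by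
  have slice0 : ∀ n : ℕ, (⟨fun v => min (max (v - n * δ) 0) δ, by fun_prop⟩ : C(ℝ, ℝ)) 0 = 0 := by
    intro n
    have h0 : 0 ≤ n * δ := by positivity
    simp [h0, hδ.le]
  have trunc0 : ∀ n : ℕ, (⟨fun v => min v (n * δ), by fun_prop⟩ : C(ℝ, ℝ)) 0 = 0 := by
    intro n
    have h0 : 0 ≤ n * δ := by positivity
    simpa using h0
  have key : ∀ n : ℕ, ρ (f.compLeft ⟨fun v => min v ((n + 2 : ℕ) * δ), by fun_prop⟩) ≤
      ρ (f.compLeft ⟨fun v => min v ((2 : ℕ) * δ), by fun_prop⟩) +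
      ρ (g.compLeft ⟨fun v => min v (n * δ), by fun_prop⟩) := by
    intro n
    induction n with
    | zero =>
      have : 0 ≤ ρ (g.compLeft ⟨fun v => min v ((0 : ℕ) * δ), by fun_prop⟩) := by
        apply hρ.positive
        intro x
        rw [CompactlySupportedContinuousMap.compLeft_apply (trunc0 0)]
        simpa using hg x
      simpa using this
    | succ n ih =>
      have e1 := hρ.map_truncate_succ f hδ.le (n + 2)
      have e2 := hρ.map_truncate_succ g hδ.le n
      have e3 : ρ (f.compLeft ⟨fun v => min (max (v - (n + 2 : ℕ) * δ) 0) δ, by fun_prop⟩) ≤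
          ρ (g.compLeft ⟨fun v => min (max (v - n * δ) 0) δ, by fun_prop⟩) := by
        apply hρ.le_of_eq_on_support _ _ δ hδ.le
        · intro x
          rw [CompactlySupportedContinuousMap.compLeft_apply (slice0 _)]
          exact le_min (le_max_right _ _) hδ.le
        · intro x
          rw [CompactlySupportedContinuousMap.compLeft_apply (slice0 _)]
          exact le_min (le_max_right _ _) hδ.le
        · intro x
          rw [CompactlySupportedContinuousMap.compLeft_apply (slice0 _)]
          exact min_le_right _ _
        · intro x
          rw [CompactlySupportedContinuousMap.compLeft_apply (slice0 _)]
          exact min_le_right _ _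
        · intro x hx
          rw [CompactlySupportedContinuousMap.compLeft_apply (slice0 _)] at hx ⊢
          simp only [ContinuousMap.coe_mk] at hx ⊢
          have h1 : ((n + 2 : ℕ) : ℝ) * δ < f x := by
            by_contra hcon
            exact hx (by rw [max_eq_right (by linarith), min_eq_left hδ.le])
          have h2 := hfg x
          push_cast at h1
          rw [max_eq_left (by nlinarith), min_eq_right (by nlinarith)]
      rw [show n + 1 + 2 = (n + 2) + 1 by ring, e1, e2]
      linarith
  have e4 : ρ (f.compLeft ⟨fun v => min v ((2 : ℕ) * δ), by fun_prop⟩) ≤ 2 * δ * ρ h := by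
    rw [← hρ.homogeneous]
    apply hρ.le_of_eq_on_support _ _ (2 * δ) (by positivity)
    · intro x
      rw [CompactlySupportedContinuousMap.compLeft_apply (trunc0 _)]
      exact le_min (hf x) (by positivity)
    · intro x
      have := (hh x).1
      simp only [CompactlySupportedContinuousMap.smul_apply, smul_eq_mul]
      positivity
    · intro x
      have := (hh x).2
      simp only [CompactlySupportedContinuousMap.smul_apply, smul_eq_mul]
      nlinarith
    · intro x
      rw [CompactlySupportedContinuousMap.compLeft_apply (trunc0 _)]
      exact min_le_right _ _
    · intro x hx
      rw [CompactlySupportedContinuousMap.compLeft_apply (trunc0 _)] at hx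
      have : f x ≠ 0 := by
        intro h0
        apply hx
        simp only [ContinuousMap.coe_mk, h0]
        exact min_eq_left (by positivity)
      simp [hfh x this]
  obtain ⟨a, ha⟩ : BddAbove (Set.range f) :=
    (f.hasCompactSupport.isCompact_range f.continuous).bddAbove
  obtain ⟨b, hb⟩ : BddAbove (Set.range g) :=
    (g.hasCompactSupport.isCompact_range g.continuous).bddAbove
  obtain ⟨n, hn⟩ := exists_nat_ge (max a b / δ)
  rw [div_le_iff₀ hδ] at hn
  have e5 : f.compLeft ⟨fun v => min v ((n + 2 : ℕ) * δ), by fun_prop⟩ = f := by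
    ext x
    rw [CompactlySupportedContinuousMap.compLeft_apply (trunc0 _)]
    refine min_eq_left ?_
    have h1 : f x ≤ a := ha ⟨x, rfl⟩
    have h2 := le_max_left a b
    push_cast
    nlinarith
  have e6 : g.compLeft ⟨fun v => min v (n * δ), by fun_prop⟩ = g := by
    ext x
    rw [CompactlySupportedContinuousMap.compLeft_apply (trunc0 _)]
    refine min_eq_left ?_
    have h1 : g x ≤ b := hb ⟨x, rfl⟩
    have h2 := le_max_right a b
    linarith
  have := key n
  rw [e5, e6] at this
  linarith

theorem map_eq_pos_sub_neg (hρ : IsQuasiIntegral ρ) (f : C_c(X, ℝ)) :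
    ρ f = ρ (f.compLeft ⟨fun v => max v 0, by fun_prop⟩) -
      ρ (f.compLeft ⟨fun v => max (-v) 0, by fun_prop⟩) := by
  have p0 : (⟨fun v => max v 0, by fun_prop⟩ : C(ℝ, ℝ)) 0 = 0 := by simp
  have n0 : (⟨fun v => max (-v) 0, by fun_prop⟩ : C(ℝ, ℝ)) 0 = 0 := by simp
  have h := hρ.additive f f ⟨fun v => v, by fun_prop, rfl, fun x => rfl⟩
    (f.compLeft ⟨fun v => max (-v) 0, by fun_prop⟩)
    ⟨fun v => max (-v) 0, by fun_prop, by simp,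
      fun x => CompactlySupportedContinuousMap.compLeft_apply n0 _ _⟩
  have e : f + f.compLeft ⟨fun v => max (-v) 0, by fun_prop⟩ =
      f.compLeft ⟨fun v => max v 0, by fun_prop⟩ := by
    ext x
    rw [CompactlySupportedContinuousMap.add_apply,
      CompactlySupportedContinuousMap.compLeft_apply p0,
      CompactlySupportedContinuousMap.compLeft_apply n0]
    simp only [ContinuousMap.coe_mk]
    rcases le_total (f x) 0 with h | h
    · rw [max_eq_left (by linarith), max_eq_right h]; ring
    · rw [max_eq_right (by linarith), max_eq_left h]; ring
  rw [e] at h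
  linarith

theorem abs_sub_le (hρ : IsQuasiIntegral ρ) (f g h : C_c(X, ℝ)) {δ : ℝ} (hδ : 0 < δ)
    (hh : ∀ x, 0 ≤ h x ∧ h x ≤ 1) (hfh : ∀ x, f x ≠ 0 → h x = 1) (hgh : ∀ x, g x ≠ 0 → h x = 1)
    (hfg : ∀ x, |f x - g x| ≤ δ) : |ρ f - ρ g| ≤ 4 * δ * ρ h := by
  have p0 : (⟨fun v => max v 0, by fun_prop⟩ : C(ℝ, ℝ)) 0 = 0 := by simp
  have n0 : (⟨fun v => max (-v) 0, by fun_prop⟩ : C(ℝ, ℝ)) 0 = 0 := by simp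
  have main : ∀ (φ : C(ℝ, ℝ)) (_ : φ 0 = 0) (_ : ∀ v, 0 ≤ φ v)
      (_ : ∀ v w, |v - w| ≤ δ → φ v ≤ φ w + δ) (f g : C_c(X, ℝ)) (_ : ∀ x, f x ≠ 0 → h x = 1)
      (_ : ∀ x, |f x - g x| ≤ δ),
      ρ (f.compLeft φ) ≤ ρ (g.compLeft φ) + 2 * δ * ρ h := by
    intro φ h0 hpos hφ f g hfh hfg
    apply hρ.le_add_of_nonneg _ _ _ hδ _ _ hh
    · intro x hx
      rw [CompactlySupportedContinuousMap.compLeft_apply h0] at hx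
      exact hfh x fun h => hx (by rw [h, h0])
    · intro x
      rw [CompactlySupportedContinuousMap.compLeft_apply h0,
        CompactlySupportedContinuousMap.compLeft_apply h0]
      exact hφ _ _ (hfg x)
    · intro x
      rw [CompactlySupportedContinuousMap.compLeft_apply h0]
      exact hpos _
    · intro x
      rw [CompactlySupportedContinuousMap.compLeft_apply h0]
      exact hpos _
  have hgf : ∀ x, |g x - f x| ≤ δ := fun x => by rw [abs_sub_comm]; exact hfg x
  have P : ∀ v w : ℝ, |v - w| ≤ δ → max v 0 ≤ max w 0 + δ := by
    intro v w hvw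
    have h1 := (abs_le.1 hvw).2
    have h2 := le_max_left w 0
    have h3 := le_max_right w 0
    exact max_le (by linarith) (by linarith)
  have N : ∀ v w : ℝ, |v - w| ≤ δ → max (-v) 0 ≤ max (-w) 0 + δ := by
    intro v w hvw
    refine P _ _ ?_
    rwa [neg_sub_neg, abs_sub_comm]
  have a1 := main ⟨fun v => max v 0, by fun_prop⟩ p0 (fun v => le_max_right _ _) P f g hfh hfg
  have a2 := main ⟨fun v => max v 0, by fun_prop⟩ p0 (fun v => le_max_right _ _) P g f hgh hgf
  have a3 := main ⟨fun v => max (-v) 0, by fun_prop⟩ n0 (fun v => le_max_right _ _) N f g hfh hfg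
  have a4 := main ⟨fun v => max (-v) 0, by fun_prop⟩ n0 (fun v => le_max_right _ _) N g f hgh hgf
  rw [hρ.map_eq_pos_sub_neg f, hρ.map_eq_pos_sub_neg g, abs_le]
  constructor <;> linarith

end IsQuasiIntegral

section Repeated

variable {X Y : Type*} [TopologicalSpace X] [TopologicalSpace Y]

/-- The section `f_y : x ↦ f (x, y)` of `f ∈ C_c(X × Y)`, an element of `C_c(X)`. -/
def sectionAt [T2Space X] (f : C_c(X × Y, ℝ)) (y : Y) : C_c(X, ℝ) where
  toFun x := f (x, y)
  continuous_toFun := f.continuous.comp (by fun_prop)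
  hasCompactSupport' := by
    refine HasCompactSupport.intro (f.hasCompactSupport.isCompact.image continuous_fst) ?_
    intro x hx
    by_contra h
    exact hx ⟨(x, y), subset_tsupport _ h, rfl⟩

/-- The function `T_ρ(f) : y ↦ ρ (f_y)`, an element of `C_c(Y)`. -/
def repeatedInner [T2Space X] [LocallyCompactSpace X] [T2Space Y] {ρ : C_c(X, ℝ) → ℝ}
    (hρ : IsQuasiIntegral ρ) (f : C_c(X × Y, ℝ)) : C_c(Y, ℝ) where
  toFun y := ρ (sectionAt f y)
  continuous_toFun := by
    have hK : IsCompact (Prod.fst '' tsupport f) :=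
      f.hasCompactSupport.isCompact.image continuous_fst
    obtain ⟨h, h1, -, h3, h4⟩ := exists_continuous_one_zero_of_isCompact hK isClosed_empty
      (Set.disjoint_empty _)
    let k : C_c(X, ℝ) := ⟨h, h3⟩
    have hk : ∀ x, 0 ≤ k x ∧ k x ≤ 1 := h4
    have hfk : ∀ y x, sectionAt f y x ≠ 0 → k x = 1 := fun y x hx =>
      h1 ⟨(x, y), subset_tsupport _ hx, rfl⟩
    have hk0 : 0 ≤ ρ k := hρ.positive k fun x => (hk x).1
    rw [continuous_iff_continuousAt]
    intro y
    rw [ContinuousAt, Metric.tendsto_nhds]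
    intro ε hε
    set δ := ε / (4 * ρ k + 1) with hδ
    have hδ0 : 0 < δ := by positivity
    have ev : ∀ᶠ y' in 𝓝 y, ∀ x ∈ Prod.fst '' tsupport f, |f (x, y') - f (x, y)| < δ := by
      apply hK.eventually_forall_of_forall_eventually
      intro x _
      have hc : Continuous fun z : Y × X => |f (z.2, z.1) - f (z.2, y)| := by
        have := f.continuous
        fun_prop
      exact hc.continuousAt.eventually_lt continuousAt_const (by simpa using hδ0)
    filter_upwards [ev] with y' hy'
    have := hρ.abs_sub_le (sectionAt f y') (sectionAt f y) k hδ0 hk (hfk y') (hfk y) (by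
      intro x
      change |f (x, y') - f (x, y)| ≤ δ
      by_cases hx : x ∈ Prod.fst '' tsupport f
      · exact (hy' x hx).le
      · have hz : ∀ z, f (x, z) = 0 := fun z => by
          by_contra hne
          exact hx ⟨(x, z), subset_tsupport _ hne, rfl⟩
        simpa [hz] using hδ0.le)
    rw [Real.dist_eq]
    refine this.trans_lt ?_
    rw [hδ]
    have hpos : 0 < 4 * ρ k + 1 := by positivity
    rw [show 4 * (ε / (4 * ρ k + 1)) * ρ k = ε * (4 * ρ k) / (4 * ρ k + 1) by ring,
      div_lt_iff₀ hpos]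
    nlinarith
  hasCompactSupport' := by
    refine HasCompactSupport.intro (f.hasCompactSupport.isCompact.image continuous_snd) ?_
    intro y hy
    have : sectionAt f y = 0 := by
      ext x
      by_contra h
      exact hy ⟨(x, y), subset_tsupport _ h, rfl⟩
    rw [this, hρ.map_zero]

/-- The repeated functional `η × ρ` on `C_c(X × Y)`, `f ↦ η (T_ρ(f))`. -/
def repeatedQI [T2Space X] [LocallyCompactSpace X] [T2Space Y] (η : C_c(Y, ℝ) → ℝ)
    {ρ : C_c(X, ℝ) → ℝ} (hρ : IsQuasiIntegral ρ) : C_c(X × Y, ℝ) → ℝ :=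
  fun f => η (repeatedInner hρ f)

end Repeated

/-! Write `T f` for `y ↦ ρ (f_y)`. Everything turns on whether `ρ` charges two nonnegative functions
with disjoint cozero sets.

If it charges such a pair `g₁, g₂`, the tensors `g₁ ⊗ φ / ρ g₁` and `g₂ ⊗ ψ / ρ g₂` with `φ, ψ ≥ 0`
are again disjoint, hence lie in one singly generated algebra. `T` sends them to `φ` and `ψ`, and
their sum to `φ + ψ`, so additivity of `η × ρ` on that algebra forces `η` to be additive
(`isLinearMap_of_isQuasiIntegral_repeatedQI`).

If it charges no such pair (`VanishesOnDisjoint`), then `φ ↦ ρ (φ ∘ f)` is a positive linear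
functional that kills one of any two disjoint functions, hence a multiple of a point evaluation, and
the multiple `c` can be taken the same for all `f` (`VanishesOnDisjoint.exists_isPointwise`). Then
`T (φ ∘ f) = c φ (T f / c)`, so `T` maps `B(f)` into `B(T f)`, where any quasi-integral `η` is
additive.

It remains to identify `VanishesOnDisjoint` with almost simplicity. A simple measure cannot be `1`
on two disjoint open sets. Conversely, for pointwise `ρ` the set function `tmOf ρ` takes only the
values `0` and `c`, and its additivity reduces to facts about null sets. -/

open CompactlySupportedContinuousMap (compLeft_apply)

/-! ### Singly generated algebras and bump functions -/

section Generation

variable {X : Type*} [TopologicalSpace X]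

theorem compLeft_mem_singlyGenerated (f : C_c(X, ℝ)) {φ : C(ℝ, ℝ)} (hφ : φ 0 = 0) :
    f.compLeft φ ∈ singlyGenerated f :=
  ⟨φ, φ.continuous.continuousOn, hφ, fun x => compLeft_apply hφ f x⟩

/-- The functions generating `B(f)` may be taken continuous on the whole real line. -/
theorem exists_eq_compLeft_of_mem_singlyGenerated {f g : C_c(X, ℝ)} (hg : g ∈ singlyGenerated f) :
    ∃ φ : C(ℝ, ℝ), φ 0 = 0 ∧ g = f.compLeft φ := by
  obtain ⟨φ, hφ, h0, hgφ⟩ := hg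
  have hK : IsCompact (Set.range f) := f.hasCompactSupport.isCompact_range f.continuous
  -- If `X` is compact, `0` may lie outside `f(X)`. The range is closed, so `0` is then isolated in
  -- the enlarged set, and the extension by Tietze can be made to keep the value `0` there.
  have hc : ContinuousOn φ (insert 0 (Set.range f)) := by
    by_cases h : (0 : ℝ) ∈ Set.range f
    · rwa [Set.insert_eq_of_mem h]
    · intro v hv
      rcases hv with rfl | hv
      · have : 𝓝[insert 0 (Set.range f)] (0 : ℝ) = pure 0 := by
          rw [nhdsWithin_insert]
          have h' : 𝓝[Set.range f] (0 : ℝ) = ⊥ := by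
            rw [← notMem_closure_iff_nhdsWithin_eq_bot, hK.isClosed.closure_eq]
            exact h
          rw [h', sup_bot_eq]
        rw [ContinuousWithinAt, this]
        exact tendsto_pure_nhds _ _
      · rw [ContinuousWithinAt, nhdsWithin_insert_of_ne (by rintro rfl; exact h hv)]
        exact hφ v hv
  obtain ⟨ψ, hψ⟩ := ContinuousMap.exists_restrict_eq (Y := ℝ) (hK.insert 0).isClosed
    ⟨_, continuousOn_iff_continuous_domRestrict.1 hc⟩
  have hψ' : ∀ v ∈ insert 0 (Set.range f), ψ v = φ v := fun v hv =>
    congrArg (fun F => F ⟨v, hv⟩) hψ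
  have hψ0 : ψ 0 = 0 := by rw [hψ' 0 (Set.mem_insert _ _), h0]
  refine ⟨ψ, hψ0, ?_⟩
  ext x
  rw [compLeft_apply hψ0, hψ' _ (Set.mem_insert_of_mem _ ⟨x, rfl⟩), hgφ]

/-- The value `1` is needed on a neighbourhood of `K`, not just on `K`: only then does subtracting
the bump remove `K` from a closed support. -/
theorem exists_bump [T2Space X] [LocallyCompactSpace X] {K U : Set X} (hK : IsCompact K)
    (hU : IsOpen U) (hKU : K ⊆ U) :
    ∃ k : C_c(X, ℝ), (∀ x, 0 ≤ k x ∧ k x ≤ 1) ∧ tsupport k ⊆ U ∧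
      ∃ V, IsOpen V ∧ K ⊆ V ∧ ∀ x ∈ V, k x = 1 := by
  obtain ⟨L, hL, hKL, hLU⟩ := exists_compact_between hK hU hKU
  obtain ⟨M, hM, hLM, hMU⟩ := exists_compact_between hL hU hLU
  obtain ⟨k, h1, h0, hc, h01⟩ := exists_continuous_one_zero_of_isCompact hL
    isOpen_interior.isClosed_compl (Set.disjoint_compl_right_iff_subset.2 hLM)
  refine ⟨⟨k, hc⟩, h01, ?_, interior L, isOpen_interior, hKL, fun x hx => h1 (interior_subset hx)⟩
  refine (closure_minimal ?_ hM.isClosed).trans hMU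
  intro x hx
  by_contra h
  exact hx (h0 fun hx' => h (interior_subset hx'))

end Generation

/-! ### Linear calculus of a quasi-integral on `B(f)` -/

namespace IsQuasiIntegral

variable {X : Type*} [TopologicalSpace X] {ρ : C_c(X, ℝ) → ℝ}

theorem map_compLeft_add (hρ : IsQuasiIntegral ρ) (f : C_c(X, ℝ)) {φ ψ : C(ℝ, ℝ)}
    (hφ : φ 0 = 0) (hψ : ψ 0 = 0) :
    ρ (f.compLeft (φ + ψ)) = ρ (f.compLeft φ) + ρ (f.compLeft ψ) := by
  rw [← hρ.additive f _ (compLeft_mem_singlyGenerated f hφ) _ (compLeft_mem_singlyGenerated f hψ)]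
  congr 1
  ext x
  simp [compLeft_apply, hφ, hψ]

theorem map_compLeft_smul (hρ : IsQuasiIntegral ρ) (f : C_c(X, ℝ)) (a : ℝ) {φ : C(ℝ, ℝ)}
    (hφ : φ 0 = 0) : ρ (f.compLeft (a • φ)) = a * ρ (f.compLeft φ) := by
  rw [← hρ.homogeneous]
  congr 1
  ext x
  simp [compLeft_apply, hφ]

theorem map_compLeft_sub (hρ : IsQuasiIntegral ρ) (f : C_c(X, ℝ)) {φ ψ : C(ℝ, ℝ)}
    (hφ : φ 0 = 0) (hψ : ψ 0 = 0) :
    ρ (f.compLeft (φ - ψ)) = ρ (f.compLeft φ) - ρ (f.compLeft ψ) := by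
  rw [sub_eq_add_neg, ← neg_one_smul ℝ ψ, hρ.map_compLeft_add f hφ (by simp [hψ]),
    hρ.map_compLeft_smul f _ hψ]
  ring

theorem map_compLeft_mono (hρ : IsQuasiIntegral ρ) (f : C_c(X, ℝ)) {φ ψ : C(ℝ, ℝ)}
    (hφ : φ 0 = 0) (hψ : ψ 0 = 0) (h : ∀ x, φ (f x) ≤ ψ (f x)) :
    ρ (f.compLeft φ) ≤ ρ (f.compLeft ψ) := by
  have := hρ.positive (f.compLeft (ψ - φ)) fun x => by
    rw [compLeft_apply (by simp [hφ, hψ])]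
    simpa using h x
  rw [hρ.map_compLeft_sub f hψ hφ] at this
  linarith

theorem map_compLeft_sum (hρ : IsQuasiIntegral ρ) (f : C_c(X, ℝ)) {ι : Type*} (s : Finset ι)
    {φ : ι → C(ℝ, ℝ)} (hφ : ∀ i, φ i 0 = 0) :
    ρ (f.compLeft (∑ i ∈ s, φ i)) = ∑ i ∈ s, ρ (f.compLeft (φ i)) := by
  classical
  induction s using Finset.induction_on with
  | empty =>
    have := hρ.map_compLeft_smul f 0 (φ := 0) rfl
    simpa using this
  | insert i s hi ih =>
    rw [Finset.sum_insert hi, Finset.sum_insert hi, hρ.map_compLeft_add f (hφ i) (by simp [hφ]), ih]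

/-- Disjoint nonnegative functions are the positive and negative parts of `g - h`, so both belong to
`B(g - h)`. -/
theorem map_smul_add_smul (hρ : IsQuasiIntegral ρ) {g h : C_c(X, ℝ)} (hg : ∀ x, 0 ≤ g x)
    (hh : ∀ x, 0 ≤ h x) (hgh : ∀ x, g x = 0 ∨ h x = 0) (a b : ℝ) :
    ρ (a • g + b • h) = a * ρ g + b * ρ h := by
  have hga : a • g ∈ singlyGenerated (g - h) := by
    refine ⟨fun v => a * max v 0, by fun_prop, by simp, fun x => ?_⟩
    rcases hgh x with h0 | h0 <;> simp [h0, hg x, hh x]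
  have hhb : b • h ∈ singlyGenerated (g - h) := by
    refine ⟨fun v => b * max (-v) 0, by fun_prop, by simp, fun x => ?_⟩
    rcases hgh x with h0 | h0 <;> simp [h0, hg x, hh x]
  rw [hρ.additive _ _ hga _ hhb, hρ.homogeneous, hρ.homogeneous]

theorem map_add_of_disjoint (hρ : IsQuasiIntegral ρ) {g h : C_c(X, ℝ)} (hg : ∀ x, 0 ≤ g x)
    (hh : ∀ x, 0 ≤ h x) (hgh : ∀ x, g x = 0 ∨ h x = 0) : ρ (g + h) = ρ g + ρ h := by
  simpa using hρ.map_smul_add_smul hg hh hgh 1 1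

/-- The truncation `v ↦ (v - ε)⁺`. -/
noncomputable def _root_.posPartSub (ε : ℝ) : C(ℝ, ℝ) := ⟨fun v => max (v - ε) 0, by fun_prop⟩

@[simp] theorem _root_.posPartSub_apply (ε v : ℝ) : posPartSub ε v = max (v - ε) 0 := rfl

/-- Split `g = min g ε + (g - ε)⁺`. The first summand is dominated by `ε • k` for a bump `k` equal
to `1` on the support of `g`, so it contributes less than `ρ g` once `ε` is small. -/
theorem exists_map_posPartSub_pos [T2Space X] [LocallyCompactSpace X] (hρ : IsQuasiIntegral ρ)
    {g : C_c(X, ℝ)} (hg : ∀ x, 0 ≤ g x) (hpos : 0 < ρ g) :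
    ∃ ε > 0, 0 < ρ (g.compLeft (posPartSub ε)) := by
  obtain ⟨k, hk, -, V, -, hV, hk1⟩ := exists_bump g.hasCompactSupport isOpen_univ
    (Set.subset_univ _)
  have hk0 : 0 ≤ ρ k := hρ.positive k fun x => (hk x).1
  -- Chosen so that `ε * ρ k < ρ g`; the `+ 1` covers `ρ k = 0`.
  set ε := ρ g / (2 * (ρ k + 1)) with hε
  have hε0 : 0 < ε := by positivity
  have h0 : posPartSub ε 0 = 0 := by simp [hε0.le]
  let m : C(ℝ, ℝ) := ⟨fun v => min v ε, by fun_prop⟩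
  have hm : m 0 = 0 := by simp [m, hε0.le]
  have hsum : ρ g = ρ (g.compLeft m) + ρ (g.compLeft (posPartSub ε)) := by
    rw [← hρ.map_compLeft_add g hm h0]
    congr 1
    ext x
    rw [compLeft_apply (by simp [hm, h0])]
    simp only [ContinuousMap.add_apply, posPartSub_apply, m, ContinuousMap.coe_mk]
    rcases le_total (g x) ε with h | h
    · rw [min_eq_left h, max_eq_right (by linarith), add_zero]
    · rw [min_eq_right h, max_eq_left (by linarith)]; ring
  have hle : ρ (g.compLeft m) ≤ ρ (ε • k) := by
    apply hρ.le_of_eq_on_support _ _ ε hε0.le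
    · intro x
      rw [compLeft_apply hm]
      exact le_min (hg x) hε0.le
    · intro x
      have := (hk x).1
      simp only [CompactlySupportedContinuousMap.smul_apply, smul_eq_mul]
      positivity
    · intro x
      have := (hk x).2
      simp only [CompactlySupportedContinuousMap.smul_apply, smul_eq_mul]
      nlinarith
    · intro x
      rw [compLeft_apply hm]
      exact min_le_right _ _
    · intro x hx
      rw [compLeft_apply hm] at hx
      have : g x ≠ 0 := fun h => hx (by rw [h, hm])
      simp [hk1 x (hV (subset_tsupport _ this))]
  rw [hρ.homogeneous] at hle
  refine ⟨ε, hε0, ?_⟩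
  have : ε * ρ k < ρ g := by
    rw [hε, div_mul_eq_mul_div, div_lt_iff₀ (by positivity)]
    nlinarith
  linarith

end IsQuasiIntegral

/-! ### Functionals charging no disjoint pair are point evaluations on each `B(f)` -/

section NoDisjointPair

variable {X : Type*} [TopologicalSpace X]

/-- `ρ` does not charge two nonnegative functions with disjoint cozero sets. -/
def VanishesOnDisjoint (ρ : C_c(X, ℝ) → ℝ) : Prop :=
  ∀ g h : C_c(X, ℝ), (∀ x, 0 ≤ g x) → (∀ x, 0 ≤ h x) → (∀ x, g x = 0 ∨ h x = 0) →
    ρ g = 0 ∨ ρ h = 0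

/-- On each singly generated subalgebra `ρ` is `c` times a point evaluation. -/
def IsPointwise (ρ : C_c(X, ℝ) → ℝ) (c : ℝ) : Prop :=
  ∀ f : C_c(X, ℝ), ∃ t : ℝ, ∀ φ : C(ℝ, ℝ), φ 0 = 0 → ρ (f.compLeft φ) = c * φ t

variable {ρ : C_c(X, ℝ) → ℝ}

/-- The parts `φ⁺ ∘ f` and `φ⁻ ∘ f` are disjoint, so one has value `0`; their values have difference
`0`, so both vanish. -/
theorem VanishesOnDisjoint.map_abs_eq_zero (h : VanishesOnDisjoint ρ) (hρ : IsQuasiIntegral ρ)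
    (f : C_c(X, ℝ)) {φ : C(ℝ, ℝ)} (hφ : φ 0 = 0) (h0 : ρ (f.compLeft φ) = 0) :
    ρ (f.compLeft |φ|) = 0 := by
  let p : C(ℝ, ℝ) := ⟨fun v => max (φ v) 0, by fun_prop⟩
  let n : C(ℝ, ℝ) := ⟨fun v => max (-φ v) 0, by fun_prop⟩
  have hp : p 0 = 0 := by simp [p, hφ]
  have hn : n 0 = 0 := by simp [n, hφ]
  have e1 : φ = p - n := by
    ext v
    simp only [p, n, ContinuousMap.sub_apply, ContinuousMap.coe_mk]
    rcases le_total (φ v) 0 with h | h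
    · rw [max_eq_right h, max_eq_left (by linarith)]; ring
    · rw [max_eq_left h, max_eq_right (by linarith)]; ring
  have e2 : |φ| = p + n := by
    ext v
    simp only [p, n, ContinuousMap.abs_apply, ContinuousMap.add_apply, ContinuousMap.coe_mk]
    rcases le_total (φ v) 0 with h | h
    · rw [max_eq_right h, max_eq_left (by linarith), abs_of_nonpos h]; ring
    · rw [max_eq_left h, max_eq_right (by linarith), abs_of_nonneg h]; ring
  rw [e1, hρ.map_compLeft_sub f hp hn] at h0
  rw [e2, hρ.map_compLeft_add f hp hn]
  have := h (f.compLeft p) (f.compLeft n)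
    (fun x => by rw [compLeft_apply hp]; exact le_max_right _ _)
    (fun x => by rw [compLeft_apply hn]; exact le_max_right _ _)
    (fun x => by
      rw [compLeft_apply hp, compLeft_apply hn]
      rcases le_total (φ (f x)) 0 with h | h
      · exact Or.inl (max_eq_right h)
      · exact Or.inr (max_eq_right (by linarith)))
  rcases this with h | h <;> linarith

/-- With `L φ = ρ (φ ∘ f)` and `e = |φ₀|`, the function `φ - (L φ / L e) e` is in the kernel of `L`,
hence so is its absolute value. A common zero `t` of all these functions with `e t > 0` gives `L φ =
(L e / e t) φ t`. Compactness supplies it: otherwise a finite sum `S` of them is positive on `K`,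
and a multiple of `S` dominates `(e - ε)⁺` although `L S = 0 < L (e - ε)⁺`. -/
theorem VanishesOnDisjoint.exists_point [T2Space X] [LocallyCompactSpace X]
    (h : VanishesOnDisjoint ρ) (hρ : IsQuasiIntegral ρ) (f : C_c(X, ℝ)) {φ₀ : C(ℝ, ℝ)}
    (hφ₀ : φ₀ 0 = 0) (hne : ρ (f.compLeft φ₀) ≠ 0) :
    ∃ a > 0, ∃ t ≠ 0, ∀ φ : C(ℝ, ℝ), φ 0 = 0 → ρ (f.compLeft φ) = a * φ t := by
  set e : C(ℝ, ℝ) := |φ₀| with he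
  have e0 : e 0 = 0 := by simp [he, hφ₀]
  have epos : ∀ v, 0 ≤ e v := fun v => abs_nonneg _
  have hLe : 0 < ρ (f.compLeft e) := by
    have h1 := hρ.map_compLeft_mono f hφ₀ e0 fun x => le_abs_self _
    have h2 := hρ.map_compLeft_mono f (φ := -φ₀) (by simp [hφ₀]) e0 fun x => neg_le_abs _
    rw [← neg_one_smul ℝ φ₀, hρ.map_compLeft_smul f _ hφ₀] at h2
    rcases lt_or_gt_of_ne hne with h | h <;> linarith
  obtain ⟨ε, hε, hLε⟩ := hρ.exists_map_posPartSub_pos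
    (fun x => by rw [compLeft_apply e0]; exact epos _) hLe
  have hε0 : posPartSub ε 0 = 0 := by simp [hε.le]
  -- The cutoff at `ε` guarantees `e t > 0` for points of `K`, while `(e - ε)⁺` vanishes at every
  -- value of `f` outside `K`.
  set K := Set.range f ∩ {v | ε ≤ e v} with hK
  have hKc : IsCompact K := (f.hasCompactSupport.isCompact_range f.continuous).inter_right
    (isClosed_le continuous_const e.continuous)
  let ψ : {φ : C(ℝ, ℝ) // φ 0 = 0} → C(ℝ, ℝ) := fun φ =>
    |φ.1 - (ρ (f.compLeft φ.1) / ρ (f.compLeft e)) • e|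
  have hψ0 : ∀ φ, ψ φ 0 = 0 := fun φ => by simp [ψ, e0, φ.2]
  have hLψ : ∀ φ, ρ (f.compLeft (ψ φ)) = 0 := fun φ => by
    apply h.map_abs_eq_zero hρ f (by simp [e0, φ.2])
    rw [hρ.map_compLeft_sub f φ.2 (by simp [e0]), hρ.map_compLeft_smul f _ e0,
      div_mul_cancel₀ _ hLe.ne', sub_self]
  obtain ⟨t, htK, ht⟩ : (K ∩ ⋂ φ, {v | ψ φ v = 0}).Nonempty := by
    by_contra hcon
    obtain ⟨s, hs⟩ := hKc.elim_finite_subfamily_closed (fun φ => {v | ψ φ v = 0})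
      (fun φ => isClosed_eq (ψ φ).continuous continuous_const) (Set.not_nonempty_iff_eq_empty.1 hcon)
    set S : C(ℝ, ℝ) := ∑ φ ∈ s, ψ φ with hS
    have hS0 : S 0 = 0 := by simp [hS, hψ0]
    have hSv : ∀ v, S v = ∑ φ ∈ s, ψ φ v := fun v => by simp [hS]
    have hψpos : ∀ φ v, 0 ≤ ψ φ v := fun φ v => abs_nonneg _
    have hSpos : ∀ v, 0 ≤ S v := fun v => by
      rw [hSv]; exact Finset.sum_nonneg fun φ _ => hψpos φ v
    have hSne : ∀ v ∈ K, S v ≠ 0 := by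
      intro v hv hv0
      rw [hSv, Finset.sum_eq_zero_iff_of_nonneg fun φ _ => hψpos φ v] at hv0
      exact (Set.eq_empty_iff_forall_notMem.1 hs) v ⟨hv, by simpa using hv0⟩
    have hLS : ρ (f.compLeft S) = 0 := by
      rw [hS, hρ.map_compLeft_sum f s hψ0]
      exact Finset.sum_eq_zero fun φ _ => hLψ φ
    obtain ⟨C, hC⟩ := hKc.bddAbove_image (f := fun v => e v / S v)
      (e.continuous.continuousOn.div S.continuous.continuousOn hSne)
    have hle : ρ ((f.compLeft e).compLeft (posPartSub ε)) ≤ ρ (f.compLeft (|C| • S)) := by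
      have hcomp : (f.compLeft e).compLeft (posPartSub ε) = f.compLeft ((posPartSub ε).comp e) := by
        ext x
        rw [compLeft_apply hε0, compLeft_apply e0, compLeft_apply (by simp [e0, hε.le])]
        rfl
      rw [hcomp]
      apply hρ.map_compLeft_mono f (by simp [e0, hε.le]) (by simp [hS0])
      intro x
      simp only [ContinuousMap.comp_apply, posPartSub_apply, ContinuousMap.smul_apply, smul_eq_mul]
      have hS' := hSpos (f x)
      have hSC : 0 ≤ |C| * S (f x) := by positivity
      refine max_le ?_ hSC
      by_cases hx : ε ≤ e (f x)
      · have hxK : f x ∈ K := ⟨⟨x, rfl⟩, hx⟩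
        have hC' : e (f x) / S (f x) ≤ C := hC ⟨_, hxK, rfl⟩
        rw [div_le_iff₀ (lt_of_le_of_ne hS' (hSne _ hxK).symm)] at hC'
        have := mul_le_mul_of_nonneg_right (le_abs_self C) hS'
        linarith
      · linarith
    rw [hρ.map_compLeft_smul f _ hS0, hLS, mul_zero] at hle
    linarith
  have het : 0 < e t := hε.trans_le htK.2
  refine ⟨ρ (f.compLeft e) / e t, by positivity, t, ?_, fun φ hφ => ?_⟩
  · rintro rfl
    exact het.ne' e0
  · have := Set.mem_iInter.1 ht ⟨φ, hφ⟩
    simp only [ψ, Set.mem_ofPred_eq, ContinuousMap.abs_apply, abs_eq_zero,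
      ContinuousMap.sub_apply, ContinuousMap.smul_apply, smul_eq_mul, sub_eq_zero] at this
    rw [this]
    field_simp

/-- The weight of the point evaluation is attained on every function that is `1` on a set where
the weight is concentrated. -/
theorem VanishesOnDisjoint.map_eq_weight [T2Space X] [LocallyCompactSpace X]
    (h : VanishesOnDisjoint ρ) (hρ : IsQuasiIntegral ρ) {f k : C_c(X, ℝ)} {a : ℝ} (ha : 0 < a)
    (hf : ∀ φ : C(ℝ, ℝ), φ 0 = 0 → ρ (f.compLeft φ) = a * φ 1) (hf0 : ∀ x, 0 ≤ f x)
    (hk : ∀ x, 0 ≤ k x ∧ k x ≤ 1) (hfk : ∀ x, f x ≠ 0 → k x = 1) : ρ k = a := by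
  let m : C(ℝ, ℝ) := ⟨fun v => min v 1, by fun_prop⟩
  have m0 : m 0 = 0 := by simp [m]
  have p0 : posPartSub 1 0 = 0 := by simp
  -- Both functions are recovered from `k + f`: `k = min (k + f) 1` and `f = (k + f - 1)⁺`. Hence
  -- one point evaluation, of weight `b` at `s`, governs both.
  have ek : k = (k + f).compLeft m := by
    ext x
    rw [compLeft_apply m0]
    simp only [m, ContinuousMap.coe_mk, CompactlySupportedContinuousMap.add_apply]
    by_cases hx : f x = 0
    · simp [hx, (hk x).2]
    · simp [hfk x hx, hf0 x]
  have ef : ∀ φ : C(ℝ, ℝ), φ 0 = 0 → f.compLeft φ = (k + f).compLeft (φ.comp (posPartSub 1)) := by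
    intro φ hφ
    ext x
    rw [compLeft_apply hφ, compLeft_apply (by simp [hφ])]
    simp only [ContinuousMap.comp_apply, posPartSub_apply,
      CompactlySupportedContinuousMap.add_apply]
    by_cases hx : f x = 0
    · simp [hx, (hk x).2]
    · simp [hfk x hx, hf0 x]
  -- Testing on `f` and `f²` gives `b r = a` and `b r² = a` with `r = (s - 1)⁺`, so `r = 1` and `b =
  -- a`.
  have hid := hf (ContinuousMap.id ℝ) rfl
  have hsq := hf ⟨fun v => v ^ 2, by fun_prop⟩ (by simp)
  rw [ef _ rfl] at hid
  rw [ef _ (by simp)] at hsq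
  obtain ⟨b, hb, s, -, hs⟩ := h.exists_point hρ (k + f)
    (φ₀ := (ContinuousMap.id ℝ).comp (posPartSub 1)) (by simp) (by rw [hid]; simpa using ha.ne')
  rw [hs _ (by simp)] at hid hsq
  simp only [ContinuousMap.comp_apply, posPartSub_apply, ContinuousMap.id_apply,
    ContinuousMap.coe_mk, one_pow, mul_one] at hid hsq
  have hpos : max (s - 1) 0 ≠ 0 := fun h0 => by rw [h0] at hid; linarith
  have h1 : max (s - 1) 0 = 1 := by
    have : b * max (s - 1) 0 * max (s - 1) 0 = b * max (s - 1) 0 := by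
      rw [hid, ← hid, mul_assoc, ← sq, hsq, hid]
    exact mul_left_cancel₀ (mul_ne_zero hb.ne' hpos) (by rw [this, mul_one])
  rw [h1, mul_one] at hid
  have hs1 : 1 ≤ s := by
    by_contra hcon
    rw [max_eq_right (by linarith)] at h1
    exact zero_ne_one h1
  rw [ek, hs m m0]
  simp only [m, ContinuousMap.coe_mk, min_eq_right hs1, mul_one, hid]

/-- Weights for different `f` are compared through one bump `k` that is `1` on both supports: by
`VanishesOnDisjoint.map_eq_weight` each weight equals `ρ k`. -/
theorem VanishesOnDisjoint.exists_isPointwise [T2Space X] [LocallyCompactSpace X]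
    (h : VanishesOnDisjoint ρ) (hρ : IsQuasiIntegral ρ) : ∃ c > 0, IsPointwise ρ c := by
  by_cases hz : ∃ (f : C_c(X, ℝ)) (φ : C(ℝ, ℝ)), φ 0 = 0 ∧ ρ (f.compLeft φ) ≠ 0
  swap
  · push Not at hz
    -- For the zero functional any weight works, with evaluation at `0`.
    exact ⟨1, one_pos, fun f => ⟨0, fun φ hφ => by rw [hz f φ hφ, hφ, mul_zero]⟩⟩
  have normalize : ∀ (f : C_c(X, ℝ)) (a t : ℝ), t ≠ 0 →
      (∀ φ : C(ℝ, ℝ), φ 0 = 0 → ρ (f.compLeft φ) = a * φ t) →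
      ∃ f' : C_c(X, ℝ), (∀ x, 0 ≤ f' x) ∧
        ∀ φ : C(ℝ, ℝ), φ 0 = 0 → ρ (f'.compLeft φ) = a * φ 1 := by
    intro f a t ht hf
    -- Moves the evaluation point to `1` and makes the function nonnegative without changing the
    -- weight.
    let q : C(ℝ, ℝ) := ⟨fun v => |v / t|, by fun_prop⟩
    have q0 : q 0 = 0 := by simp [q]
    refine ⟨f.compLeft q, fun x => by rw [compLeft_apply q0]; exact abs_nonneg _, fun φ hφ => ?_⟩
    have : (f.compLeft q).compLeft φ = f.compLeft (φ.comp q) := by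
      ext x
      rw [compLeft_apply hφ, compLeft_apply q0, compLeft_apply (by simp [q0, hφ])]
      rfl
    rw [this, hf _ (by simp [q0, hφ])]
    simp [q, ht]
  obtain ⟨f₀, φ₀, hφ₀, hne₀⟩ := hz
  obtain ⟨c, hc, t₀, ht₀, hf₀⟩ := h.exists_point hρ f₀ hφ₀ hne₀
  obtain ⟨f₁, hf₁, hf₁'⟩ := normalize f₀ c t₀ ht₀ hf₀
  refine ⟨c, hc, fun f => ?_⟩
  by_cases hf : ∃ φ : C(ℝ, ℝ), φ 0 = 0 ∧ ρ (f.compLeft φ) ≠ 0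
  swap
  · push Not at hf
    exact ⟨0, fun φ hφ => by rw [hf φ hφ, hφ, mul_zero]⟩
  obtain ⟨φ, hφ, hne⟩ := hf
  obtain ⟨a, ha, t, ht, hat⟩ := h.exists_point hρ f hφ hne
  obtain ⟨f₂, hf₂, hf₂'⟩ := normalize f a t ht hat
  obtain ⟨k, hk, -, V, -, hV, hk1⟩ := exists_bump
    (f₁.hasCompactSupport.isCompact.union f₂.hasCompactSupport.isCompact) isOpen_univ
    (Set.subset_univ _)
  have e1 := h.map_eq_weight hρ hc hf₁' hf₁ hk fun x hx =>
    hk1 x (hV (Or.inl (subset_tsupport _ hx)))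
  have e2 := h.map_eq_weight hρ ha hf₂' hf₂ hk fun x hx =>
    hk1 x (hV (Or.inr (subset_tsupport _ hx)))
  exact ⟨t, by rw [← e1, e2]; exact hat⟩

end NoDisjointPair

/-! ### Sections, tensors and linearity from the nonnegative cone -/

section Product

variable {X Y : Type*} [TopologicalSpace X] [T2Space X] [TopologicalSpace Y]

theorem sectionAt_mem_singlyGenerated {f g : C_c(X × Y, ℝ)} (hg : g ∈ singlyGenerated f) (y : Y) :
    sectionAt g y ∈ singlyGenerated (sectionAt f y) := by
  obtain ⟨φ, hφ, h0, h⟩ := hg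
  exact ⟨φ, hφ.mono (by rintro _ ⟨x, rfl⟩; exact ⟨(x, y), rfl⟩), h0, fun x => h (x, y)⟩

variable [T2Space Y]

/-- The function `(x, y) ↦ g x * φ y`. -/
def tensorFun (g : C_c(X, ℝ)) (φ : C_c(Y, ℝ)) : C_c(X × Y, ℝ) where
  toFun z := g z.1 * φ z.2
  continuous_toFun := by
    have := g.continuous
    have := φ.continuous
    fun_prop
  hasCompactSupport' := by
    refine HasCompactSupport.intro
      (g.hasCompactSupport.isCompact.prod φ.hasCompactSupport.isCompact) ?_
    intro z hz
    by_contra h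
    exact hz ⟨subset_tsupport _ (left_ne_zero_of_mul h), subset_tsupport _ (right_ne_zero_of_mul h)⟩

@[simp] theorem tensorFun_apply (g : C_c(X, ℝ)) (φ : C_c(Y, ℝ)) (z : X × Y) :
    tensorFun g φ z = g z.1 * φ z.2 := rfl

end Product

/-- A quasi-integral respects `f = f⁺ - f⁻`, so it suffices to apply additivity to `(φ + ψ)⁺ + φ⁻ +
ψ⁻ = (φ + ψ)⁻ + φ⁺ + ψ⁺`. -/
theorem IsQuasiIntegral.isLinearMap_of_nonneg {Y : Type*} [TopologicalSpace Y]
    {η : C_c(Y, ℝ) → ℝ} (hη : IsQuasiIntegral η)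
    (h : ∀ φ ψ : C_c(Y, ℝ), (∀ y, 0 ≤ φ y) → (∀ y, 0 ≤ ψ y) → η (φ + ψ) = η φ + η ψ) :
    IsLinearMap ℝ η := by
  refine ⟨fun φ ψ => ?_, fun a φ => hη.homogeneous a φ⟩
  have p0 : (⟨fun v => max v 0, by fun_prop⟩ : C(ℝ, ℝ)) 0 = 0 := by simp
  have n0 : (⟨fun v => max (-v) 0, by fun_prop⟩ : C(ℝ, ℝ)) 0 = 0 := by simp
  have e1 := hη.map_eq_pos_sub_neg φ
  have e2 := hη.map_eq_pos_sub_neg ψ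
  have e3 := hη.map_eq_pos_sub_neg (φ + ψ)
  set P : C_c(Y, ℝ) → C_c(Y, ℝ) := fun f => f.compLeft ⟨fun v => max v 0, by fun_prop⟩ with hP
  set N : C_c(Y, ℝ) → C_c(Y, ℝ) := fun f => f.compLeft ⟨fun v => max (-v) 0, by fun_prop⟩ with hN
  have Pap : ∀ f y, P f y = max (f y) 0 := fun f y => compLeft_apply p0 f y
  have Nap : ∀ f y, N f y = max (-f y) 0 := fun f y => compLeft_apply n0 f y
  have Ppos : ∀ f y, 0 ≤ P f y := fun f y => by rw [Pap]; exact le_max_right _ _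
  have Npos : ∀ f y, 0 ≤ N f y := fun f y => by rw [Nap]; exact le_max_right _ _
  have hPN : ∀ f y, f y = P f y - N f y := fun f y => by
    rw [Pap, Nap]
    rcases le_total (f y) 0 with h | h
    · rw [max_eq_right h, max_eq_left (by linarith)]; ring
    · rw [max_eq_left h, max_eq_right (by linarith)]; ring
  have e4 : P (φ + ψ) + (N φ + N ψ) = N (φ + ψ) + (P φ + P ψ) := by
    ext y
    have h1 := hPN φ y
    have h2 := hPN ψ y
    have h3 := hPN (φ + ψ) y
    simp only [CompactlySupportedContinuousMap.add_apply] at h3 ⊢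
    linarith
  have sum_pos : ∀ f g : C_c(Y, ℝ), (∀ y, 0 ≤ f y) → (∀ y, 0 ≤ g y) → ∀ y, 0 ≤ (f + g) y :=
    fun f g hf hg y => add_nonneg (hf y) (hg y)
  have e5 := congrArg η e4
  rw [h _ _ (Ppos _) (sum_pos _ _ (Npos _) (Npos _)), h _ _ (Npos _) (Npos _),
    h _ _ (Npos _) (sum_pos _ _ (Ppos _) (Ppos _)), h _ _ (Ppos _) (Ppos _)] at e5
  change η φ = η (P φ) - η (N φ) at e1
  change η ψ = η (P ψ) - η (N ψ) at e2
  change η (φ + ψ) = η (P (φ + ψ)) - η (N (φ + ψ)) at e3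
  linarith

/-! ### The repeated functional -/

section RepeatedQuasiIntegral

variable {X Y : Type*} [TopologicalSpace X] [T2Space X] [LocallyCompactSpace X]
  [TopologicalSpace Y] [T2Space Y] {η : C_c(Y, ℝ) → ℝ} {ρ : C_c(X, ℝ) → ℝ}

theorem repeatedInner_apply (hρ : IsQuasiIntegral ρ) (f : C_c(X × Y, ℝ)) (y : Y) :
    repeatedInner hρ f y = ρ (sectionAt f y) := rfl

theorem repeatedInner_add (hρ : IsQuasiIntegral ρ) {f g h : C_c(X × Y, ℝ)}
    (hg : g ∈ singlyGenerated f) (hh : h ∈ singlyGenerated f) :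
    repeatedInner hρ (g + h) = repeatedInner hρ g + repeatedInner hρ h := by
  ext y
  exact hρ.additive _ _ (sectionAt_mem_singlyGenerated hg y) _
    (sectionAt_mem_singlyGenerated hh y)

/-- Homogeneity and positivity are inherited, and the inner map is additive on `B(f)` section by
section; only the additivity of `η` on the images is at stake. -/
theorem isQuasiIntegral_repeatedQI_of_additive (hη : IsQuasiIntegral η) (hρ : IsQuasiIntegral ρ)
    (hadd : ∀ f : C_c(X × Y, ℝ), ∀ g ∈ singlyGenerated f, ∀ h ∈ singlyGenerated f,
      η (repeatedInner hρ g + repeatedInner hρ h) =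
        η (repeatedInner hρ g) + η (repeatedInner hρ h)) :
    IsQuasiIntegral (repeatedQI η hρ) where
  homogeneous a f := by
    rw [repeatedQI, repeatedQI, ← hη.homogeneous]
    congr 1
    ext y
    exact hρ.homogeneous a (sectionAt f y)
  additive f g hg h hh := by
    rw [repeatedQI, repeatedInner_add hρ hg hh, hadd f g hg h hh, repeatedQI, repeatedQI]
  positive f hf := hη.positive _ fun y => hρ.positive _ fun x => hf (x, y)

/-- If `ρ` evaluates at `t` on `B(f_y)`, then `ρ (f_y) = c t` determines `t`, so `ρ (φ ∘ f_y) = c φ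
(ρ (f_y) / c)`. A weight independent of `y` is essential here. -/
theorem IsPointwise.repeatedInner_mem_singlyGenerated {c : ℝ} (hc : 0 < c) (h : IsPointwise ρ c)
    (hρ : IsQuasiIntegral ρ) {f g : C_c(X × Y, ℝ)} (hg : g ∈ singlyGenerated f) :
    repeatedInner hρ g ∈ singlyGenerated (repeatedInner hρ f) := by
  obtain ⟨φ, hφ, rfl⟩ := exists_eq_compLeft_of_mem_singlyGenerated hg
  refine ⟨fun v => c * φ (v / c), by fun_prop, by simp [hφ], fun y => ?_⟩
  obtain ⟨t, ht⟩ := h (sectionAt f y)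
  have e1 : ρ (sectionAt f y) = c * t := by
    have := ht (ContinuousMap.id ℝ) rfl
    rwa [show (sectionAt f y).compLeft (ContinuousMap.id ℝ) = sectionAt f y by
      ext x; rw [compLeft_apply rfl]; rfl] at this
  have e2 : sectionAt (f.compLeft φ) y = (sectionAt f y).compLeft φ := by
    ext x
    rw [compLeft_apply hφ]
    exact compLeft_apply hφ f (x, y)
  rw [repeatedInner_apply, repeatedInner_apply, e2, ht φ hφ, e1]
  change c * φ t = c * φ (c * t / c)
  rw [mul_div_cancel_left₀ _ hc.ne']

theorem IsPointwise.isQuasiIntegral_repeatedQI {c : ℝ} (hc : 0 < c) (h : IsPointwise ρ c)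
    (hη : IsQuasiIntegral η) (hρ : IsQuasiIntegral ρ) : IsQuasiIntegral (repeatedQI η hρ) :=
  isQuasiIntegral_repeatedQI_of_additive hη hρ fun f _ hg _ hh =>
    hη.additive (repeatedInner hρ f) _ (h.repeatedInner_mem_singlyGenerated hc hρ hg) _
      (h.repeatedInner_mem_singlyGenerated hc hρ hh)

theorem isLinearMap_of_isQuasiIntegral_repeatedQI (hη : IsQuasiIntegral η)
    (hρ : IsQuasiIntegral ρ) (h : ¬ VanishesOnDisjoint ρ)
    (hr : IsQuasiIntegral (repeatedQI η hρ)) : IsLinearMap ℝ η := by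
  simp only [VanishesOnDisjoint] at h
  push Not at h
  obtain ⟨g₁, g₂, h₁, h₂, h₁₂, n₁, n₂⟩ := h
  refine hη.isLinearMap_of_nonneg fun φ ψ hφ hψ => ?_
  have key := hr.map_add_of_disjoint (g := tensorFun g₁ ((ρ g₁)⁻¹ • φ))
    (h := tensorFun g₂ ((ρ g₂)⁻¹ • ψ))
    (fun z => mul_nonneg (h₁ _) (mul_nonneg (inv_nonneg.2 (hρ.positive _ h₁)) (hφ _)))
    (fun z => mul_nonneg (h₂ _) (mul_nonneg (inv_nonneg.2 (hρ.positive _ h₂)) (hψ _)))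
    (fun z => by rw [tensorFun_apply, tensorFun_apply]; rcases h₁₂ z.1 with h | h <;> rw [h] <;> simp)
  have single : ∀ (g : C_c(X, ℝ)) (χ : C_c(Y, ℝ)), ρ g ≠ 0 →
      repeatedInner hρ (tensorFun g ((ρ g)⁻¹ • χ)) = χ := by
    intro g χ hg
    ext y
    rw [repeatedInner_apply, show sectionAt (tensorFun g ((ρ g)⁻¹ • χ)) y =
      ((ρ g)⁻¹ * χ y) • g by ext x; exact mul_comm _ _, hρ.homogeneous]
    field_simp
  have sum : repeatedInner hρ (tensorFun g₁ ((ρ g₁)⁻¹ • φ) + tensorFun g₂ ((ρ g₂)⁻¹ • ψ)) =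
      φ + ψ := by
    ext y
    rw [repeatedInner_apply, show sectionAt (tensorFun g₁ ((ρ g₁)⁻¹ • φ) +
      tensorFun g₂ ((ρ g₂)⁻¹ • ψ)) y = ((ρ g₁)⁻¹ * φ y) • g₁ + ((ρ g₂)⁻¹ * ψ y) • g₂ by
        ext x; simp [sectionAt, mul_comm], hρ.map_smul_add_smul h₁ h₂ h₁₂]
    simp only [CompactlySupportedContinuousMap.add_apply]
    field_simp
  rwa [repeatedQI, sum, repeatedQI, repeatedQI, single _ _ n₁, single _ _ n₂] at key

end RepeatedQuasiIntegral

/-! ### Almost simple topological measures and pointwise functionals -/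

section AlmostSimple

variable {X : Type*} [TopologicalSpace X] {ρ : C_c(X, ℝ) → ℝ}

theorem tmOnOpen_ne_zero_iff {U : Set X} :
    tmOnOpen ρ U ≠ 0 ↔
      ∃ f : C_c(X, ℝ), (∀ x, 0 ≤ f x ∧ f x ≤ 1) ∧ tsupport f ⊆ U ∧ 0 < ρ f := by
  simp [tmOnOpen, ENNReal.ofReal_eq_zero]

theorem tsupport_subset_of_eq_zero {f g : C_c(X, ℝ)} (h : ∀ x, g x = 0 → f x = 0) :
    tsupport f ⊆ tsupport g :=
  closure_mono fun x hx h0 => hx (h x h0)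

theorem tmOf_mono {A B : Set X} (h : A ⊆ B) : tmOf ρ A ≤ tmOf ρ B :=
  iInf_mono fun _ => iInf_mono fun _ => iInf_mono' fun hB => ⟨h.trans hB, le_rfl⟩

theorem tmOf_eq_zero_of_subset {A U : Set X} (hU : IsOpen U) (hAU : A ⊆ U)
    (h : tmOnOpen ρ U = 0) : tmOf ρ A = 0 :=
  le_antisymm ((tmOf_mono hAU).trans_eq (by rw [tmOf_of_isOpen ρ hU, h])) bot_le

/-- Disjoint open sets: a function supported in the union splits. -/
theorem IsQuasiIntegral.tmOnOpen_union_eq_zero [T2Space X] [LocallyCompactSpace X]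
    (hρ : IsQuasiIntegral ρ) {U V : Set X} (hU : IsOpen U) (hV : IsOpen V) (hUV : Disjoint U V)
    (hU0 : tmOnOpen ρ U = 0) (hV0 : tmOnOpen ρ V = 0) : tmOnOpen ρ (U ∪ V) = 0 := by
  by_contra hne
  obtain ⟨f, hf, hfs, hpos⟩ := tmOnOpen_ne_zero_iff.1 hne
  -- On the support of `f`, `k` imitates the indicator of `U`: it is `0` on `V` and `1` near the
  -- rest of the support, so `f * k` and `f - f * k` are disjoint.
  obtain ⟨k, hk, hks, W, hW, hDW, hkW⟩ := exists_bump
    (f.hasCompactSupport.isCompact.inter_right hV.isClosed_compl) hU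
    (fun x hx => (hfs hx.1).resolve_right hx.2)
  have hkV : ∀ x ∈ V, k x = 0 := fun x hx => by
    by_contra h
    exact Set.disjoint_left.1 hUV (hks (subset_tsupport _ h)) hx
  have hk1 : ∀ x, x ∉ V → f x ≠ 0 → k x = 1 := fun x hx h =>
    hkW x (hDW ⟨subset_tsupport _ h, hx⟩)
  have hg : ∀ x, 0 ≤ (f * k) x ∧ (f * k) x ≤ 1 := fun x =>
    ⟨mul_nonneg (hf x).1 (hk x).1, mul_le_one₀ (hf x).2 (hk x).1 (hk x).2⟩
  have hh : ∀ x, 0 ≤ (f - f * k) x ∧ (f - f * k) x ≤ 1 := fun x => by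
    have h1 := hf x
    have h2 := hk x
    simp only [CompactlySupportedContinuousMap.sub_apply, CompactlySupportedContinuousMap.mul_apply]
    constructor <;> nlinarith
  have hsum := hρ.map_add_of_disjoint (fun x => (hg x).1) (fun x => (hh x).1) fun x => by
    simp only [CompactlySupportedContinuousMap.sub_apply, CompactlySupportedContinuousMap.mul_apply]
    by_cases hx : x ∈ V
    · simp [hkV x hx]
    · by_cases h0 : f x = 0
      · simp [h0]
      · simp [hk1 x hx h0]
  rw [add_sub_cancel] at hsum
  have hgU : tsupport (f * k) ⊆ U := by
    refine subset_trans ?_ hks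
    rw [CompactlySupportedContinuousMap.coe_mul]
    exact tsupport_mul_subset_right
  have hhV : tsupport (f - f * k) ⊆ V := by
    intro x hx
    by_contra hxV
    have hxf : x ∈ tsupport f := tsupport_subset_of_eq_zero (fun z h0 => by simp [h0]) hx
    obtain ⟨z, hzW, hz⟩ := mem_closure_iff.1 hx W hW (hDW ⟨hxf, hxV⟩)
    exact hz (by simp [hkW z hzW])
  have h1 : ¬ 0 < ρ (f * k) := fun h => tmOnOpen_ne_zero_iff.2 ⟨_, hg, hgU, h⟩ hU0
  have h2 : ¬ 0 < ρ (f - f * k) := fun h => tmOnOpen_ne_zero_iff.2 ⟨_, hh, hhV, h⟩ hV0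
  linarith

/-- A test function `f` on `W` need not split additively, so it is replaced by a larger `h` equal to
`1` wherever `f` or a bump `k` around `D` is nonzero. Then `k` and `h - k` both lie in `B(h + k)`;
the first is supported in `A`, the second in `W \ D ⊆ U`. -/
theorem IsQuasiIntegral.tmOnOpen_eq_zero_of_diff [T2Space X] [LocallyCompactSpace X]
    (hρ : IsQuasiIntegral ρ) {W A U D : Set X} (hW : IsOpen W) (hA : IsOpen A) (hAW : A ⊆ W)
    (hD : IsCompact D) (hDA : D ⊆ A) (hWU : W \ D ⊆ U)
    (hA0 : tmOnOpen ρ A = 0) (hU0 : tmOnOpen ρ U = 0) : tmOnOpen ρ W = 0 := by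
  by_contra hne
  obtain ⟨f, hf, hfs, hpos⟩ := tmOnOpen_ne_zero_iff.1 hne
  obtain ⟨k, hk, hks, V, hV, hDV, hkV⟩ := exists_bump hD hA hDA
  obtain ⟨h, hh, hhs, V', -, hV', hh1⟩ := exists_bump
    (f.hasCompactSupport.isCompact.union k.hasCompactSupport.isCompact) hW
    (Set.union_subset hfs (hks.trans hAW))
  have hkh : ∀ x, k x ≠ 0 → h x = 1 := fun x hx => hh1 x (hV' (Or.inr (subset_tsupport _ hx)))
  have hle : ρ f ≤ ρ h := hρ.le_of_eq_on_support f h 1 zero_le_one (fun x => (hf x).1)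
    (fun x => (hh x).1) (fun x => (hh x).2) (fun x => (hf x).2)
    (fun x hx => hh1 x (hV' (Or.inl (subset_tsupport _ hx))))
  have m1 : k ∈ singlyGenerated (h + k) := by
    refine ⟨fun v => max (v - 1) 0, by fun_prop, by simp, fun x => ?_⟩
    by_cases hx : k x = 0
    · simp [hx, (hh x).2]
    · simp [hkh x hx, (hk x).1]
  have m2 : h - k ∈ singlyGenerated (h + k) := by
    refine ⟨fun v => min v 1 - max (v - 1) 0, by fun_prop, by simp, fun x => ?_⟩
    by_cases hx : k x = 0
    · simp [hx, (hh x).2]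
    · simp [hkh x hx, (hk x).1]
  have hsum := hρ.additive _ _ m1 _ m2
  rw [add_sub_cancel] at hsum
  have hd : ∀ x, 0 ≤ (h - k) x ∧ (h - k) x ≤ 1 := fun x => by
    rw [CompactlySupportedContinuousMap.sub_apply]
    have h1 := hk x
    have h2 := hh x
    by_cases hx : k x = 0
    · rw [hx]; constructor <;> linarith
    · rw [hkh x hx]; constructor <;> linarith
  have hds : tsupport (h - k) ⊆ U := by
    intro x hx
    refine hWU ⟨hhs (tsupport_subset_of_eq_zero (fun z h0 => ?_) hx), fun hxD => ?_⟩
    · have : k z = 0 := by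
        by_contra hne
        rw [hkh z hne] at h0
        exact one_ne_zero h0
      simp [h0, this]
    · obtain ⟨z, hzV, hz⟩ := mem_closure_iff.1 hx V hV (hDV hxD)
      exact hz (by simp [hkV z hzV, hkh z (by simp [hkV z hzV])])
  have h1 : ¬ 0 < ρ k := fun h => tmOnOpen_ne_zero_iff.2 ⟨_, hk, hks, h⟩ hA0
  have h2 : ¬ 0 < ρ (h - k) := fun h => tmOnOpen_ne_zero_iff.2 ⟨_, hd, hds, h⟩ hU0
  linarith

theorem IsPointwise.vanishesOnDisjoint {c : ℝ} (h : IsPointwise ρ c) : VanishesOnDisjoint ρ := by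
  intro g₁ g₂ h₁ h₂ h₁₂
  obtain ⟨t, ht⟩ := h (g₁ - g₂)
  let p : C(ℝ, ℝ) := ⟨fun v => max v 0, by fun_prop⟩
  let n : C(ℝ, ℝ) := ⟨fun v => max (-v) 0, by fun_prop⟩
  have hp : p 0 = 0 := by simp [p]
  have hn : n 0 = 0 := by simp [n]
  have e1 : g₁ = (g₁ - g₂).compLeft p := by
    ext x
    rw [compLeft_apply hp]
    rcases h₁₂ x with h0 | h0 <;> simp [p, h0, h₁ x, h₂ x]
  have e2 : g₂ = (g₁ - g₂).compLeft n := by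
    ext x
    rw [compLeft_apply hn]
    rcases h₁₂ x with h0 | h0 <;> simp [n, h0, h₁ x, h₂ x]
  rcases le_total t 0 with h0 | h0
  · left
    rw [e1, ht p hp]
    simp [p, h0]
  · right
    rw [e2, ht n hn]
    simp [n, h0]

/-- A test function is at most `1`, so its value is `c * min t 1 ≤ c`. If some test function has
positive value, its evaluation point `t` is nonzero and `min |f / t| 1` attains `c`. -/
theorem IsPointwise.tmOnOpen_eq {c : ℝ} (hc : 0 < c) (h : IsPointwise ρ c) {U : Set X}
    (hU : tmOnOpen ρ U ≠ 0) : tmOnOpen ρ U = ENNReal.ofReal c := by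
  apply le_antisymm
  · refine iSup_le fun f => iSup_le fun hf => iSup_le fun _ => ENNReal.ofReal_le_ofReal ?_
    obtain ⟨t, ht⟩ := h f
    have m0 : (⟨fun v => min v 1, by fun_prop⟩ : C(ℝ, ℝ)) 0 = 0 := by simp
    have e := ht ⟨fun v => min v 1, by fun_prop⟩ m0
    rw [show f.compLeft ⟨fun v => min v 1, by fun_prop⟩ = f by
      ext x; rw [compLeft_apply m0]; exact min_eq_left (hf x).2] at e
    rw [e]
    exact mul_le_of_le_one_right hc.le (min_le_right _ _)
  · obtain ⟨f, hf, hfU, hpos⟩ := tmOnOpen_ne_zero_iff.1 hU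
    obtain ⟨t, ht⟩ := h f
    have ht0 : t ≠ 0 := by
      rintro rfl
      have e := ht (ContinuousMap.id ℝ) rfl
      rw [show f.compLeft (ContinuousMap.id ℝ) = f by ext x; rw [compLeft_apply rfl]; rfl] at e
      simp only [ContinuousMap.id_apply, mul_zero] at e
      exact hpos.ne' e
    let q : C(ℝ, ℝ) := ⟨fun v => min |v / t| 1, by fun_prop⟩
    have q0 : q 0 = 0 := by simp [q]
    have e := ht q q0
    rw [show q t = 1 by simp [q, ht0], mul_one] at e
    rw [← e]
    refine le_iSup_of_le (f.compLeft q) (le_iSup_of_le (fun x => ?_) (le_iSup_of_le ?_ le_rfl))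
    · rw [compLeft_apply q0]
      exact ⟨le_min (abs_nonneg _) zero_le_one, min_le_right _ _⟩
    · refine (tsupport_subset_of_eq_zero fun x h0 => ?_).trans hfU
      rw [compLeft_apply q0, h0, q0]

/-- Open sets only have the values `0` and `c`, so an infimum equal to `0` is attained. -/
theorem tmOf_eq_zero_iff_of_isPointwise {c : ℝ} (hc : 0 < c) (h : IsPointwise ρ c) {A : Set X} :
    tmOf ρ A = 0 ↔ ∃ U, IsOpen U ∧ A ⊆ U ∧ tmOnOpen ρ U = 0 := by
  constructor
  · intro h0
    by_contra! hcon
    have : ENNReal.ofReal c ≤ tmOf ρ A := le_iInf fun U => le_iInf fun hU => le_iInf fun hAU =>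
      (h.tmOnOpen_eq hc (hcon U hU hAU)).ge
    rw [h0, nonpos_iff_eq_zero, ENNReal.ofReal_eq_zero] at this
    linarith
  · rintro ⟨U, hU, hAU, h0⟩
    exact tmOf_eq_zero_of_subset hU hAU h0

theorem IsPointwise.tmOf_eq {c : ℝ} (hc : 0 < c) (h : IsPointwise ρ c) {A : Set X}
    (hA : tmOf ρ A ≠ 0) : tmOf ρ A = ENNReal.ofReal c := by
  have hne : ∀ U, IsOpen U → A ⊆ U → tmOnOpen ρ U ≠ 0 := fun U hU hAU h0 =>
    hA (tmOf_eq_zero_of_subset hU hAU h0)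
  apply le_antisymm
  · exact iInf_le_of_le Set.univ (iInf_le_of_le isOpen_univ (iInf_le_of_le (Set.subset_univ _)
      (h.tmOnOpen_eq hc (hne _ isOpen_univ (Set.subset_univ _))).le))
  · exact le_iInf fun U => le_iInf fun hU => le_iInf fun hAU => (h.tmOnOpen_eq hc (hne U hU hAU)).ge

theorem tmOf_ne_zero_of_tsupport_subset {f : C_c(X, ℝ)} {c : ℝ} (hc : 0 < c)
    (h : IsPointwise ρ c) (hf : ∀ x, 0 ≤ f x ∧ f x ≤ 1) (hpos : 0 < ρ f) :
    tmOf ρ (tsupport f) ≠ 0 := by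
  rw [Ne, tmOf_eq_zero_iff_of_isPointwise hc h]
  rintro ⟨U, -, hfU, h0⟩
  exact tmOnOpen_ne_zero_iff.2 ⟨f, hf, hfU, hpos⟩ h0

theorem IsPointwise.exists_isCompact_tmOf_ne_zero {c : ℝ} (hc : 0 < c) (h : IsPointwise ρ c)
    {A : Set X} (hA : IsCompact A ∨ IsOpen A) (hne : tmOf ρ A ≠ 0) :
    ∃ K ⊆ A, IsCompact K ∧ tmOf ρ K ≠ 0 := by
  rcases hA with hA | hA
  · exact ⟨A, subset_rfl, hA, hne⟩
  · rw [tmOf_of_isOpen ρ hA] at hne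
    obtain ⟨f, hf, hfA, hpos⟩ := tmOnOpen_ne_zero_iff.1 hne
    exact ⟨tsupport f, hfA, f.hasCompactSupport.isCompact,
      tmOf_ne_zero_of_tsupport_subset hc h hf hpos⟩

/-- Charged compact subsets of the two sets would have disjoint open neighbourhoods, each carrying a
test function of positive value. -/
theorem IsPointwise.tmOf_eq_zero_or_of_disjoint [T2Space X] {c : ℝ} (hc : 0 < c)
    (h : IsPointwise ρ c) {A B : Set X} (hA : IsCompact A ∨ IsOpen A) (hB : IsCompact B ∨ IsOpen B)
    (hAB : Disjoint A B) : tmOf ρ A = 0 ∨ tmOf ρ B = 0 := by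
  by_contra! hcon
  obtain ⟨K, hKA, hK, hK0⟩ := h.exists_isCompact_tmOf_ne_zero hc hA hcon.1
  obtain ⟨L, hLB, hL, hL0⟩ := h.exists_isCompact_tmOf_ne_zero hc hB hcon.2
  obtain ⟨U, V, hU, hV, hKU, hLV, hUV⟩ :=
    SeparatedNhds.of_isCompact_isCompact hK hL (hAB.mono hKA hLB)
  obtain ⟨f, hf, hfU, hf0⟩ := tmOnOpen_ne_zero_iff.1 fun h0 =>
    hK0 (tmOf_eq_zero_of_subset hU hKU h0)
  obtain ⟨g, hg, hgV, hg0⟩ := tmOnOpen_ne_zero_iff.1 fun h0 =>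
    hL0 (tmOf_eq_zero_of_subset hV hLV h0)
  have := h.vanishesOnDisjoint f g (fun x => (hf x).1) (fun x => (hg x).1) fun x => by
    by_contra! hx
    exact Set.disjoint_left.1 hUV (hfU (subset_tsupport _ hx.1)) (hgV (subset_tsupport _ hx.2))
  rcases this with h0 | h0
  · exact hf0.ne' h0
  · exact hg0.ne' h0

section Union

variable [T2Space X] [LocallyCompactSpace X] {c : ℝ} {A B : Set X}

theorem tmOf_union_eq_zero_of_isCompact_of_isOpen (hρ : IsQuasiIntegral ρ) (hc : 0 < c)
    (h : IsPointwise ρ c) (hA : IsCompact A) (hB : IsOpen B)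
    (hu : IsCompact (A ∪ B) ∨ IsOpen (A ∪ B)) (hA0 : tmOf ρ A = 0) (hB0 : tmOf ρ B = 0) :
    tmOf ρ (A ∪ B) = 0 := by
  obtain ⟨U, hU, hAU, hU0⟩ := (tmOf_eq_zero_iff_of_isPointwise hc h).1 hA0
  rw [tmOf_of_isOpen ρ hB] at hB0
  rcases hu with hu | hu
  -- Compact union: `D = (A ∪ B) \ U` is compact and contained in `B`, and removing it from `B ∪ U`
  -- leaves a subset of `U`.
  · refine tmOf_eq_zero_of_subset (hB.union hU) (Set.union_subset (hAU.trans Set.subset_union_right)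
      Set.subset_union_left) (hρ.tmOnOpen_eq_zero_of_diff (hB.union hU) hB Set.subset_union_left
        (hu.inter_right hU.isClosed_compl) ?_ ?_ hB0 hU0)
    · rintro x ⟨hx | hx, hxU⟩
      · exact absurd (hAU hx) hxU
      · exact hx
    · rintro x ⟨hx | hx, hxD⟩
      · by_contra hxU
        exact hxD ⟨Or.inr hx, hxU⟩
      · exact hx
  · rw [tmOf_of_isOpen ρ hu]
    have hU0' : tmOnOpen ρ (U ∩ (A ∪ B)) = 0 := by
      rw [← tmOf_of_isOpen ρ (hU.inter hu)]
      exact tmOf_eq_zero_of_subset hU Set.inter_subset_left hU0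
    -- Open union: here `D = A`, inside the null open set `U ∩ (A ∪ B)`.
    refine hρ.tmOnOpen_eq_zero_of_diff hu (hU.inter hu) Set.inter_subset_right hA
      (Set.subset_inter hAU Set.subset_union_left) ?_ hU0' hB0
    rintro x ⟨hx, hxA⟩
    exact hx.resolve_left hxA

theorem tmOf_union_eq_zero (hρ : IsQuasiIntegral ρ) (hc : 0 < c)
    (h : IsPointwise ρ c) (hA : IsCompact A ∨ IsOpen A) (hB : IsCompact B ∨ IsOpen B)
    (hAB : Disjoint A B) (hu : IsCompact (A ∪ B) ∨ IsOpen (A ∪ B)) (hA0 : tmOf ρ A = 0)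
    (hB0 : tmOf ρ B = 0) : tmOf ρ (A ∪ B) = 0 := by
  rcases hA with hA | hA <;> rcases hB with hB | hB
  · obtain ⟨U, V, hU, hV, hAU, hBV, hUV⟩ := SeparatedNhds.of_isCompact_isCompact hA hB hAB
    obtain ⟨U', hU', hAU', hU0⟩ := (tmOf_eq_zero_iff_of_isPointwise hc h).1 hA0
    obtain ⟨V', hV', hBV', hV0⟩ := (tmOf_eq_zero_iff_of_isPointwise hc h).1 hB0
    refine tmOf_eq_zero_of_subset ((hU.inter hU').union (hV.inter hV'))
      (Set.union_subset_union (Set.subset_inter hAU hAU') (Set.subset_inter hBV hBV'))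
      (hρ.tmOnOpen_union_eq_zero (hU.inter hU') (hV.inter hV')
        (hUV.mono Set.inter_subset_left Set.inter_subset_left) ?_ ?_)
    · rw [← tmOf_of_isOpen ρ (hU.inter hU')]
      exact tmOf_eq_zero_of_subset hU' Set.inter_subset_right hU0
    · rw [← tmOf_of_isOpen ρ (hV.inter hV')]
      exact tmOf_eq_zero_of_subset hV' Set.inter_subset_right hV0
  · exact tmOf_union_eq_zero_of_isCompact_of_isOpen hρ hc h hA hB hu hA0 hB0
  · rw [Set.union_comm] at hu ⊢
    exact tmOf_union_eq_zero_of_isCompact_of_isOpen hρ hc h hB hA hu hB0 hA0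
  · rw [tmOf_of_isOpen ρ hA] at hA0
    rw [tmOf_of_isOpen ρ hB] at hB0
    rw [tmOf_of_isOpen ρ (hA.union hB)]
    exact hρ.tmOnOpen_union_eq_zero hA hB hAB hA0 hB0

/-- For additivity, one of two disjoint sets is null. If the other has value `c`, monotonicity gives
the union value `c`; if both are null, so is the union. -/
theorem IsPointwise.isTopologicalMeasure_tmOf (hρ : IsQuasiIntegral ρ) (hc : 0 < c)
    (h : IsPointwise ρ c) : IsTopologicalMeasure (tmOf ρ) where
  not_top := by
    refine ⟨∅, Or.inl isClosed_empty, ?_⟩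
    by_cases h0 : tmOf ρ (∅ : Set X) = 0
    · simp [h0]
    · rw [h.tmOf_eq hc h0]
      exact ENNReal.ofReal_ne_top
  additive A B hAB hA hB hu := by
    rcases h.tmOf_eq_zero_or_of_disjoint hc hA hB hAB with h0 | h0
    · rw [h0, zero_add]
      by_cases h1 : tmOf ρ B = 0
      · rw [h1, tmOf_union_eq_zero hρ hc h hA hB hAB hu h0 h1]
      · rw [h.tmOf_eq hc h1, h.tmOf_eq hc]
        exact fun hz => h1 (le_antisymm ((tmOf_mono Set.subset_union_right).trans_eq hz) bot_le)
    · rw [h0, add_zero]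
      by_cases h1 : tmOf ρ A = 0
      · rw [h1, tmOf_union_eq_zero hρ hc h hA hB hAB hu h1 h0]
      · rw [h.tmOf_eq hc h1, h.tmOf_eq hc]
        exact fun hz => h1 (le_antisymm ((tmOf_mono Set.subset_union_left).trans_eq hz) bot_le)
  inner U hU := by
    apply le_antisymm
    · by_cases h0 : tmOf ρ U = 0
      · rw [h0]; exact bot_le
      · obtain ⟨K, hKU, hK, hK0⟩ := h.exists_isCompact_tmOf_ne_zero hc (Or.inr hU) h0
        exact le_iSup_of_le K (le_iSup_of_le hK (le_iSup_of_le hKU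
          (by rw [h.tmOf_eq hc h0, h.tmOf_eq hc hK0])))
    · exact iSup_le fun K => iSup_le fun _ => iSup_le fun hKU => tmOf_mono hKU
  outer F _ := by
    apply le_antisymm
    · exact le_iInf fun U => le_iInf fun _ => le_iInf fun hFU => tmOf_mono hFU
    · exact iInf_mono fun U => iInf_mono fun hU => iInf_mono fun _ => (tmOf_of_isOpen ρ hU).le

end Union

theorem IsTopologicalMeasure.const_mul {μ : Set X → ℝ≥0∞} (hμ : IsTopologicalMeasure μ) {a : ℝ≥0∞}
    (ha0 : a ≠ 0) (ha : a ≠ ∞) : IsTopologicalMeasure fun A => a * μ A where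
  not_top := by
    obtain ⟨A, hA, h⟩ := hμ.not_top
    exact ⟨A, hA, ENNReal.mul_ne_top ha h⟩
  additive A B hAB hA hB hu := by rw [hμ.additive A B hAB hA hB hu, mul_add]
  inner U hU := by
    rw [hμ.inner U hU]
    simp only [ENNReal.mul_iSup]
  outer F hF := by
    rw [hμ.outer F hF]
    simp only [ENNReal.mul_iInf_of_ne ha0 ha]

theorem IsTopologicalMeasure.congr [T2Space X] {μ ν : Set X → ℝ≥0∞} (hμ : IsTopologicalMeasure μ)
    (h : ∀ A, IsClosed A ∨ IsOpen A → ν A = μ A) : IsTopologicalMeasure ν where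
  not_top := by
    obtain ⟨A, hA, h'⟩ := hμ.not_top
    exact ⟨A, hA, by rwa [h A hA]⟩
  additive A B hAB hA hB hu := by
    rw [h _ (hu.imp_left IsCompact.isClosed), h _ (hA.imp_left IsCompact.isClosed),
      h _ (hB.imp_left IsCompact.isClosed), hμ.additive A B hAB hA hB hu]
  inner U hU := by
    rw [h U (Or.inr hU), hμ.inner U hU]
    exact iSup_congr fun K => iSup_congr fun hK => by rw [h K (Or.inl hK.isClosed)]
  outer F hF := by
    rw [h F (Or.inl hF), hμ.outer F hF]
    exact iInf_congr fun U => iInf_congr fun hU => by rw [h U (Or.inr hU)]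

theorem IsSimpleQI.isAlmostSimpleQI (h : IsSimpleQI ρ) : IsAlmostSimpleQI ρ :=
  ⟨1, tmOf ρ, one_pos, h, fun A _ => by simp⟩

/-- Evaluating at the whole space forces the scalar to be `1`. -/
theorem IsAlmostSimpleQI.isSimpleQI [T2Space X] (h : IsAlmostSimpleQI ρ) (h1 : tmOf ρ Set.univ = 1) :
    IsSimpleQI ρ := by
  obtain ⟨c, μ, hc, hμ, hμρ⟩ := h
  have hu := hμρ Set.univ (Or.inl isClosed_univ)
  rw [h1] at hu
  have hc1 : (c : ℝ≥0∞) = 1 := by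
    rcases hμ.values Set.univ (Or.inl isClosed_univ) with h0 | h0
    · rw [h0, mul_zero] at hu
      exact absurd hu one_ne_zero
    · rw [h0, mul_one] at hu
      exact hu.symm
  have heq : ∀ A, IsClosed A ∨ IsOpen A → tmOf ρ A = μ A := fun A hA => by
    rw [hμρ A hA, hc1, one_mul]
  exact ⟨hμ.toIsTopologicalMeasure.congr heq, fun A hA => by
    rw [heq A hA]; exact hμ.values A hA⟩

theorem IsAlmostSimpleQI.encard_values_le (h : IsAlmostSimpleQI ρ) :
    (tmOf ρ '' {A | IsClosed A ∨ IsOpen A}).encard ≤ 2 := by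
  obtain ⟨c, μ, -, hμ, hμρ⟩ := h
  have hsub : tmOf ρ '' {A | IsClosed A ∨ IsOpen A} ⊆ {0, (c : ℝ≥0∞)} := by
    rintro _ ⟨A, hA, rfl⟩
    rw [hμρ A hA]
    rcases hμ.values A hA with h0 | h0 <;> simp [h0]
  refine (Set.encard_le_encard hsub).trans (Set.encard_insert_le _ _ |>.trans ?_)
  · rw [Set.encard_singleton]; norm_num

variable [T2Space X] [LocallyCompactSpace X]

theorem IsPointwise.isAlmostSimpleQI {c : ℝ} (hρ : IsQuasiIntegral ρ) (hc : 0 < c)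
    (h : IsPointwise ρ c) : IsAlmostSimpleQI ρ := by
  have hc0 : ENNReal.ofReal c ≠ 0 := (ENNReal.ofReal_pos.2 hc).ne'
  refine ⟨c.toNNReal, fun A => (ENNReal.ofReal c)⁻¹ * tmOf ρ A, Real.toNNReal_pos.2 hc,
    ⟨(h.isTopologicalMeasure_tmOf hρ hc).const_mul (ENNReal.inv_ne_zero.2 ENNReal.ofReal_ne_top)
      (ENNReal.inv_ne_top.2 hc0), fun A _ => ?_⟩, fun A _ => ?_⟩
  · by_cases h0 : tmOf ρ A = 0
    · left
      rw [h0, mul_zero]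
    · right
      rw [h.tmOf_eq hc h0, ENNReal.inv_mul_cancel hc0 ENNReal.ofReal_ne_top]
  · exact (ENNReal.mul_inv_cancel_left hc0 ENNReal.ofReal_ne_top).symm

/-- The closed support of `g` may leave the cozero set, but that of `(g - ε)⁺` stays in `{g ≥ ε}`;
dividing by a bound of `g` makes it a test function. -/
theorem tmOnOpen_cozero_ne_zero (hρ : IsQuasiIntegral ρ) {g : C_c(X, ℝ)} (hg : ∀ x, 0 ≤ g x)
    (hne : ρ g ≠ 0) : tmOnOpen ρ {x | g x ≠ 0} ≠ 0 := by
  obtain ⟨ε, hε, hpos⟩ := hρ.exists_map_posPartSub_pos hg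
    (lt_of_le_of_ne (hρ.positive g hg) hne.symm)
  have h0 : posPartSub ε 0 = 0 := by simp [hε.le]
  obtain ⟨b, hb⟩ : BddAbove (Set.range g) :=
    (g.hasCompactSupport.isCompact_range g.continuous).bddAbove
  have hb1 : 0 < |b| + 1 := by positivity
  refine tmOnOpen_ne_zero_iff.2 ⟨(|b| + 1)⁻¹ • g.compLeft (posPartSub ε), fun x => ?_, ?_, ?_⟩
  · have h1 : g x ≤ b := hb ⟨x, rfl⟩
    have h2 := le_abs_self b
    rw [CompactlySupportedContinuousMap.smul_apply, compLeft_apply h0, posPartSub_apply,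
      smul_eq_mul, inv_mul_eq_div]
    refine ⟨by positivity, ?_⟩
    rw [div_le_one hb1]
    exact max_le (by linarith) hb1.le
  · have hcl : IsClosed {x | ε ≤ g x} := isClosed_le continuous_const g.continuous
    refine (closure_minimal (fun x hx => ?_) hcl).trans fun x (hx : ε ≤ g x) => (hε.trans_le hx).ne'
    by_contra hlt
    apply hx
    rw [CompactlySupportedContinuousMap.smul_apply, compLeft_apply h0, posPartSub_apply,
      max_eq_right (by simpa using (not_le.1 hlt).le), smul_zero]
  · rw [hρ.homogeneous]
    positivity

/-- Two charged disjoint cozero sets would give their union the value `1 + 1` under a simple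
measure. -/
theorem IsAlmostSimpleQI.vanishesOnDisjoint (h : IsAlmostSimpleQI ρ) (hρ : IsQuasiIntegral ρ) :
    VanishesOnDisjoint ρ := by
  obtain ⟨c, μ, hc, hμ, hμρ⟩ := h
  intro g₁ g₂ h₁ h₂ h₁₂
  by_contra! hcon
  have hval : ∀ U : Set X, IsOpen U → tmOnOpen ρ U ≠ 0 → μ U = 1 := fun U hU hne => by
    refine (hμ.values U (Or.inr hU)).resolve_left fun h0 => hne ?_
    rw [← tmOf_of_isOpen ρ hU, hμρ U (Or.inr hU), h0, mul_zero]
  have o₁ : IsOpen {x | g₁ x ≠ 0} := isOpen_ne_fun g₁.continuous continuous_const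
  have o₂ : IsOpen {x | g₂ x ≠ 0} := isOpen_ne_fun g₂.continuous continuous_const
  have e := hμ.additive {x | g₁ x ≠ 0} {x | g₂ x ≠ 0} (Set.disjoint_left.2 fun x (h1 : g₁ x ≠ 0) (h2 : g₂ x ≠ 0) =>
    (h₁₂ x).elim h1 h2) (Or.inr o₁) (Or.inr o₂) (Or.inr (o₁.union o₂))
  rw [hval _ o₁ (tmOnOpen_cozero_ne_zero hρ h₁ hcon.1),
    hval _ o₂ (tmOnOpen_cozero_ne_zero hρ h₂ hcon.2)] at e
  rcases hμ.values _ (Or.inr (o₁.union o₂)) with h0 | h0 <;> rw [h0] at e <;> norm_num at e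

theorem isAlmostSimpleQI_iff_vanishesOnDisjoint (hρ : IsQuasiIntegral ρ) :
    IsAlmostSimpleQI ρ ↔ VanishesOnDisjoint ρ := by
  refine ⟨fun h => h.vanishesOnDisjoint hρ, fun h => ?_⟩
  obtain ⟨c, hc, hp⟩ := h.exists_isPointwise hρ
  exact hp.isAlmostSimpleQI hρ hc

end AlmostSimple

/-! ### The theorem -/

theorem mainTheorem2 {X Y : Type*}
    [TopologicalSpace X] [T2Space X] [LocallyCompactSpace X]
    [TopologicalSpace Y] [T2Space Y] [LocallyCompactSpace Y]
    (η : C_c(Y, ℝ) → ℝ) (ρ : C_c(X, ℝ) → ℝ)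
    (hη : IsQuasiIntegral η) (hρ : IsQuasiIntegral ρ) :
    (IsQuasiIntegral (repeatedQI η hρ) ↔ IsLinearMap ℝ η ∨ IsAlmostSimpleQI ρ) ∧
    (2 < (tmOf ρ '' {A | IsClosed A ∨ IsOpen A}).encard →
      IsQuasiIntegral (repeatedQI η hρ) → IsLinearMap ℝ η) ∧
    (IsLinearMap ℝ η ∨ IsSimpleQI ρ → IsQuasiIntegral (repeatedQI η hρ)) ∧
    (tmOf ρ Set.univ = 1 →
      (IsQuasiIntegral (repeatedQI η hρ) ↔ IsLinearMap ℝ η ∨ IsSimpleQI ρ)) := by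
  have main : IsQuasiIntegral (repeatedQI η hρ) ↔ IsLinearMap ℝ η ∨ IsAlmostSimpleQI ρ := by
    rw [isAlmostSimpleQI_iff_vanishesOnDisjoint hρ]
    constructor
    · intro hr
      by_cases h : VanishesOnDisjoint ρ
      · exact Or.inr h
      · exact Or.inl (isLinearMap_of_isQuasiIntegral_repeatedQI hη hρ h hr)
    · rintro (h | h)
      · exact isQuasiIntegral_repeatedQI_of_additive hη hρ fun _ _ _ _ _ => h.map_add _ _
      · obtain ⟨c, hc, hp⟩ := h.exists_isPointwise hρ
        exact hp.isQuasiIntegral_repeatedQI hc hη hρ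
  refine ⟨main, fun h2 hr => ?_, fun h => ?_, fun h1 => ?_⟩
  · exact (main.1 hr).resolve_right fun h => h2.not_ge h.encard_values_le
  · exact main.2 (h.imp_right IsSimpleQI.isAlmostSimpleQI)
  · rw [main]
    exact or_congr_right ⟨fun h => h.isSimpleQI h1, IsSimpleQI.isAlmostSimpleQI⟩
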